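/- Theorem 2.5. Let $b,c$ be positive integers with $b>1$ and $c>\frac{(b+1)b^2}{b-1}$, and let $\mathcal L$ be the equation $x+by=cz$. A set $A$ of positive integers is $\mathcal L$-avoiding if there are no $x,y,z\in A$ (not necessarily distinct) with $x+by=cz$. All intervals are intervals of integers. For positive integers $n,s$ put $$l_1=\Big\lfloor\tfrac{(b+1)n}{c}\Big\rfloor,\quad r_2=r_2(s)=\Big\lfloor\tfrac{l_1+bs}{c}\Big\rfloor,\quad l_2=l_2(s)=\Big\lfloor\tfrac{(b+1)r_2}{c}\Big\rfloor,$$ $$S=\Big\lfloor\tfrac{(b+1)^2n}{c\,[c^2-b(b+1)]}\Big\rfloor,\qquad s'=\min\{s\in[1,n]:\ l_2(s)<s\}.$$ There is an $N=N(b,c)$ such that for every $n\ge N$ and every $\mathcal L$-avoiding subset $A$ of $[1,n]$ of maximum size, the following holds. Let $s$ be the smallest element of $A$, and $r_2=r_2(s)$, $l_2=l_2(s)$. Then $s\in[S,S+2]$ and $A=\mathcal I_2\cup\mathcal I_1$, where: * if $s\ge s'$, then $\mathcal I_2$ is $[s,r_2]$ or $[s,r_2+1]$; * if $s<s'$, then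 $\mathcal I_2$ is $[s,r_2)$ or $[s,r_2]\setminus\{r_2-\xi_1\}$ with $\xi_1\in[1,b]$; * if $r_2+1\notin A$ and $l_1\notin A$, then $\mathcal I_1=(l_1,n]$; * if $r_2+1\notin A$ and $l_1\in A$, then $\mathcal I_1$ is $[l_1,n)$ or $[l_1,n]\setminus\{n-\xi_2\}$ with $\xi_2\in[0,n]$; * if $r_2+1\in A$ and $l_1\notin A$, then $\mathcal I_1=(l_1,n]\setminus\{l_1+\xi_3\}$ with $\xi_3\in[1,n]$; * if $r_2+1\in A$ and $l_1\in A$, then $\mathcal I_1$ is $[l_1,n)\setminus\{l_1+\xi_4\}$ or $[l_1,n]\setminus\{l_1+\xi_4,\,n-\xi_5\}$ with $\xi_4\in[1,b-1]$, $\xi_5\in[0,n]$. Moreover, in all cases where they arise, the parameters $\xi_i$ are uniquely determined by $n$ and $s$ through $$cl_2=(b+1)r_2-\xi_1,\qquad cl_1=(b+1)n-\xi_i\ \ (i\in\{2,5\}),\qquad c(r_2+1)=bs+(l_1+\xi_i)\ \ (i\in\{3,4\}).$$ -/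

import Mathlib

namespace FamilyOne

/-- `A` contains no solution of `x + b y = c z`; the variables need not take distinct values. -/
def Avoids (b c : ℕ) (A : Finset ℕ) : Prop :=
  ∀ x ∈ A, ∀ y ∈ A, ∀ z ∈ A, x + b * y ≠ c * z

/-- `A` is an avoiding subset of `[1,n]` of maximum size. -/
def IsMaximum (b c n : ℕ) (A : Finset ℕ) : Prop :=
  A ⊆ Finset.Icc 1 n ∧ Avoids b c A ∧
    ∀ B : Finset ℕ, B ⊆ Finset.Icc 1 n → Avoids b c B → B.card ≤ A.card

/-- `l₁ = ⌊(b+1) n / c⌋` (division of natural numbers rounds down). -/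
def l₁ (b c n : ℕ) : ℕ := (b + 1) * n / c

/-- `r₂ = ⌊(l₁ + b s) / c⌋`. -/
def r₂ (b c n s : ℕ) : ℕ := (l₁ b c n + b * s) / c

/-- `l₂ = ⌊(b+1) r₂ / c⌋`. -/
def l₂ (b c n s : ℕ) : ℕ := (b + 1) * r₂ b c n s / c

/-- `S = ⌊(b+1)² n / (c [c² - b(b+1)])⌋`. -/
def S (b c n : ℕ) : ℕ :=
  ⌊(((b : ℚ) + 1) ^ 2 * n) / ((c : ℚ) * ((c : ℚ) ^ 2 - b * (b + 1)))⌋₊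

/-- `s' = min {s ∈ [1,n] : l₂(s) < s}`. -/
noncomputable def sPrime (b c n : ℕ) : ℕ :=
  sInf {s : ℕ | 1 ≤ s ∧ s ≤ n ∧ l₂ b c n s < s}

/-- The possible shapes of the left-hand block `I₂`. -/
def LeftBlock (b c n s : ℕ) (I : Finset ℕ) : Prop :=
  (sPrime b c n ≤ s →
    I = Finset.Icc s (r₂ b c n s) ∨ I = Finset.Icc s (r₂ b c n s + 1)) ∧
  (s < sPrime b c n →
    I = Finset.Ico s (r₂ b c n s) ∨
    ∃ ξ₁ : ℕ, 1 ≤ ξ₁ ∧ ξ₁ ≤ b ∧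
      c * l₂ b c n s + ξ₁ = (b + 1) * r₂ b c n s ∧
      I = Finset.Icc s (r₂ b c n s) \ {r₂ b c n s - ξ₁})

/-- The possible shapes of the right-hand block `I₁` of the set `A`. -/
def RightBlock (b c n s : ℕ) (A I : Finset ℕ) : Prop :=
  (r₂ b c n s + 1 ∉ A → l₁ b c n ∉ A →
    I = Finset.Ioc (l₁ b c n) n) ∧
  (r₂ b c n s + 1 ∉ A → l₁ b c n ∈ A →
    I = Finset.Ico (l₁ b c n) n ∨
    ∃ ξ₂ : ℕ, ξ₂ ≤ n ∧
      c * l₁ b c n + ξ₂ = (b + 1) * n ∧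
      I = Finset.Icc (l₁ b c n) n \ {n - ξ₂}) ∧
  (r₂ b c n s + 1 ∈ A → l₁ b c n ∉ A →
    ∃ ξ₃ : ℕ, 1 ≤ ξ₃ ∧ ξ₃ ≤ n ∧
      c * (r₂ b c n s + 1) = b * s + (l₁ b c n + ξ₃) ∧
      I = Finset.Ioc (l₁ b c n) n \ {l₁ b c n + ξ₃}) ∧
  (r₂ b c n s + 1 ∈ A → l₁ b c n ∈ A →
    ∃ ξ₄ : ℕ, 1 ≤ ξ₄ ∧ ξ₄ ≤ b - 1 ∧
      c * (r₂ b c n s + 1) = b * s + (l₁ b c n + ξ₄) ∧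
      (I = Finset.Ico (l₁ b c n) n \ {l₁ b c n + ξ₄} ∨
       ∃ ξ₅ : ℕ, ξ₅ ≤ n ∧
        c * l₁ b c n + ξ₅ = (b + 1) * n ∧
        I = Finset.Icc (l₁ b c n) n \ {l₁ b c n + ξ₄, n - ξ₅}))

end FamilyOne

/-!
A maximum set `A` is compared with `[s, r₂] ∪ (l₁, n]`, which has no solution of `x + b y = c z` as
soon as `l₂ < s` (`avoids_Icc_union_Ioc`). The upper bound comes from solutions `x + b y = c z`
with `z ∈ A` in the range `(r₂, l₁]` between the two blocks and `x`, `y` in `(l₁, n]`: each such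
solution forces an element of `(l₁, n]` out of `A`, and it suffices to give the `z` solutions that
do not share elements.

* For `z` up to about `(b + 1) l₁ / c` (the number `cut`), take `y = s`, so that `c z - b s` is
  missing (`card_inter_Ioc_cut_le`). These elements lie in one residue class modulo `c`.
* For the larger `z`, take `x` and `y` within a bounded distance of `c z / (b + 1)`, with prescribed
  residues `y ≡ η` and `x ≡ -b η` modulo `c`. The edges joining `η` to `-b η` can be chosen to avoid
  the class of `-b s` and to be spread so evenly that double counting gives a strict gain by a
  constant factor (`IsEdgeSystem`, `exists_edgeSystem`, `card_mul_card_le`). Such a choice exists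
  because `(b + 1)² + 2 ≤ c`, which follows from `c > (b + 1) b² / (b - 1)`; how it is made depends
  on `gcd b c`. Next to `l₁`, with `e = (b + 1) n - c z`, the pairs `n - u`, `n - (e - b u)` excluded
  by a single `z` suffice (`div_succ_lt_card_Ioc_sdiff`).

So the elements of `A` in `(r₂, l₁]` never outweigh those missing from `(l₁, n]`, and equality leaves
room for at most one missing element that is not of the form `c z - b s` with `z ≤ cut`
(`card_inter_Ioc_le`).

The same estimate applied to `A ∩ [1, r₂]` shows that a least element `s < S` is at a bounded
distance from `S`, and there the pairs excluded by `z = s` inside `[s, r₂]` make `A` too small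
(`le_of_isMaximum`). On the other side `r₂` grows too slowly for `s` to exceed `s' + 1`. Once the
position of `s` is known, all the inequalities are equalities: the left block is full, or misses one
element of the only pair excluded by `s`; the elements strictly between `r₂ + 1` and `l₁` would
exclude too much; and the missing elements of `(l₁, n]` are exactly those forced by `r₂ + 1` and `l₁`.
-/

namespace FamilyOne

/-! ### Residues modulo `c` -/

lemma sq_add_two_le {b c : ℕ} (hb : 1 < b) (h : (b + 1) * b ^ 2 + c < c * b) :
    (b + 1) ^ 2 + 2 ≤ c := by
  by_contra! hlt
  obtain ⟨d, rfl⟩ : ∃ d, b = d + 2 := ⟨b - 2, by omega⟩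
  have h1 : c ≤ (d + 2 + 1) ^ 2 + 1 := by omega
  nlinarith [Nat.mul_le_mul_right (d + 1) h1]

/-- The congruence `b η ≡ -k (mod c)` has at most `gcd b c` solutions. -/
lemma card_filter_dvd_add_mul_le {b c : ℕ} (hc : 0 < c) (k : ℕ) :
    ((Finset.range c).filter (fun η => c ∣ k + b * η)).card ≤ Nat.gcd b c := by
  have hg : 0 < Nat.gcd b c := Nat.gcd_pos_of_pos_right _ hc
  obtain ⟨d, hd⟩ := Nat.gcd_dvd_right b c
  have hd0 : 0 < d := by
    rcases Nat.eq_zero_or_pos d with h | h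
    · subst h; omega
    · exact h
  rw [← Finset.card_range (Nat.gcd b c)]
  apply Finset.card_le_card_of_injOn (fun η => η / d)
  · intro η hη
    simp only [Finset.coe_filter, Finset.mem_range, Set.mem_ofPred_eq] at hη
    simp only [Finset.coe_range, Set.mem_Iio]
    apply Nat.div_lt_of_lt_mul
    calc η < c := hη.1
      _ = d * b.gcd c := by rw [mul_comm]; exact hd
  · intro x hx y hy hxy
    simp only [Finset.coe_filter, Finset.mem_range, Set.mem_ofPred_eq] at hx hy
    have h1 : b * x ≡ b * y [MOD c] := by
      have : k + b * x ≡ k + b * y [MOD c] :=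
        ((Nat.modEq_zero_iff_dvd).2 hx.2).trans ((Nat.modEq_zero_iff_dvd).2 hy.2).symm
      exact Nat.ModEq.add_left_cancel' k this
    have h2 : x ≡ y [MOD c / Nat.gcd c b] := Nat.ModEq.cancel_left_div_gcd hc h1
    have h3 : c / Nat.gcd c b = d := by
      rw [Nat.gcd_comm]
      exact Nat.div_eq_of_eq_mul_right hg hd
    rw [h3] at h2
    have h4 := Nat.div_add_mod x d
    have h5 := Nat.div_add_mod y d
    have h6 : x % d = y % d := h2
    simp only at hxy
    rw [← h4, ← h5, hxy, h6]

lemma card_filter_mod_eq_le_one {c : ℕ} {H : Finset ℕ} (hH : H ⊆ Finset.range c) (k : ℕ) :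
    (H.filter (fun η => η ≡ k [MOD c])).card ≤ 1 := by
  apply Finset.card_le_one.2
  intro x hx y hy
  simp only [Finset.mem_filter] at hx hy
  have h1 := Finset.mem_range.1 (hH hx.1)
  have h2 := Finset.mem_range.1 (hH hy.1)
  exact Nat.ModEq.eq_of_lt_of_lt (hx.2.trans hy.2.symm) h1 h2

/-- Residues `η` modulo `c` such that the edges joining `η` to `-b η` avoid the residue `-b s`
and cover each residue at most `μ` times, with more than `(b + 1) μ` edges in all. -/
def IsEdgeSystem (b c s μ : ℕ) (H : Finset ℕ) : Prop :=
  H ⊆ Finset.range c ∧ (∀ η ∈ H, ¬ c ∣ η + b * s) ∧ (∀ η ∈ H, ¬ b * η ≡ b * s [MOD c]) ∧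
  (∀ k, (H.filter (fun η => η ≡ k [MOD c])).card +
    (H.filter (fun η => c ∣ k + b * η)).card ≤ μ) ∧ (b + 1) * μ < H.card

/-- If `gcd b c` is small against `c`, all edges avoiding `-b s` form an edge system. -/
lemma exists_edgeSystem_of_gcd {b c : ℕ} (hc : 0 < c)
    (h : (b + 2) * (1 + Nat.gcd b c) < c) (s : ℕ) :
    ∃ H, IsEdgeSystem b c s (1 + Nat.gcd b c) H := by
  classical
  set X := (Finset.range c).filter (fun η => c ∣ η + b * s) with hX
  set Y := (Finset.range c).filter (fun η => b * η ≡ b * s [MOD c]) with hY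
  have hXc : X.card ≤ 1 := by
    apply Finset.card_le_one.2
    intro x hx y hy
    simp only [hX, Finset.mem_filter, Finset.mem_range] at hx hy
    have : x + b * s ≡ y + b * s [MOD c] :=
      ((Nat.modEq_zero_iff_dvd).2 hx.2).trans ((Nat.modEq_zero_iff_dvd).2 hy.2).symm
    exact Nat.ModEq.eq_of_lt_of_lt (Nat.ModEq.add_right_cancel' _ this) hx.1 hy.1
  have hYc : Y.card ≤ Nat.gcd b c := by
    refine le_trans (Finset.card_le_card ?_) (card_filter_dvd_add_mul_le (b := b) hc (b * s * (c - 1)))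
    intro x hx
    simp only [hY, Finset.mem_filter] at hx
    simp only [Finset.mem_filter]
    refine ⟨hx.1, (Nat.modEq_zero_iff_dvd).1 ?_⟩
    have h1 : b * s * (c - 1) + b * x ≡ b * s * (c - 1) + b * s [MOD c] := hx.2.add_left _
    refine h1.trans ((Nat.modEq_zero_iff_dvd).2 ⟨b * s, ?_⟩)
    obtain ⟨d, rfl⟩ : ∃ d, c = d + 1 := ⟨c - 1, by omega⟩
    simp only [Nat.add_sub_cancel]
    ring
  refine ⟨Finset.range c \ (X ∪ Y), Finset.sdiff_subset, ?_, ?_, ?_, ?_⟩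
  · intro η hη hd
    simp only [hX, hY, Finset.mem_sdiff, Finset.mem_union, Finset.mem_filter] at hη
    tauto
  · intro η hη hd
    simp only [hX, hY, Finset.mem_sdiff, Finset.mem_union, Finset.mem_filter] at hη
    tauto
  · intro k
    refine add_le_add (card_filter_mod_eq_le_one Finset.sdiff_subset k) ?_
    exact le_trans (Finset.card_le_card (Finset.filter_subset_filter _ Finset.sdiff_subset))
      (card_filter_dvd_add_mul_le hc k)
  · have h1 := Finset.le_card_sdiff (X ∪ Y) (Finset.range c)
    have h2 := Finset.card_union_le X Y
    rw [Finset.card_range] at h1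
    have h3 : (b + 2) * (1 + b.gcd c) = (b + 1) * (1 + b.gcd c) + (1 + b.gcd c) := by ring
    omega

/-- For `c = b (b + 3)` the counting of `exists_edgeSystem_of_gcd` just fails. Here the residues
`-b η` are the multiples of `b`, each of which gets a preimage `η` that is no multiple of `b`. -/
lemma exists_edgeSystem_of_eq {b : ℕ} (hb : 4 ≤ b) (s : ℕ) :
    ∃ H, IsEdgeSystem b (b * (b + 3)) s 1 H := by
  classical
  set f : ℕ → ℕ := fun ρ => if b ∣ ρ then ρ + (b + 3) else ρ with hf
  have hfmod : ∀ ρ, f ρ ≡ ρ [MOD (b + 3)] := by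
    intro ρ
    simp only [hf]
    split_ifs
    · exact Nat.add_modEq_right
    · rfl
  have hfdvd : ∀ ρ, ¬ b ∣ f ρ := by
    intro ρ
    simp only [hf]
    split_ifs with h
    · intro h1
      have h2 : b ∣ b + 3 := (Nat.dvd_add_right h).1 h1
      have h3 : b ∣ 3 := (Nat.dvd_add_right (dvd_refl b)).1 h2
      have := Nat.le_of_dvd (by norm_num) h3
      omega
    · exact h
  have hmul : ∀ x y, b * x ≡ b * y [MOD b * (b + 3)] ↔ x ≡ y [MOD (b + 3)] := fun x y =>
    Nat.ModEq.mul_left_cancel_iff' (by omega)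
  set H := ((Finset.range (b + 3)).filter (fun ρ => ¬ ρ ≡ s [MOD (b + 3)])).image f with hH
  have hinj : Set.InjOn f (Finset.range (b + 3)) := by
    intro x hx y hy hxy
    simp only [Finset.coe_range, Set.mem_Iio] at hx hy
    refine Nat.ModEq.eq_of_lt_of_lt ?_ hx hy
    exact ((hfmod x).symm.trans (by rw [hxy])).trans (hfmod y)
  have hdvd : ∀ η ∈ H, ¬ b ∣ η := by
    intro η hη
    obtain ⟨ρ, -, rfl⟩ := Finset.mem_image.1 hη
    exact hfdvd ρ
  have heq : ∀ x ∈ H, ∀ y ∈ H, x ≡ y [MOD (b + 3)] → x = y := by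
    intro x hx y hy hxy
    obtain ⟨ρ, hρ, rfl⟩ := Finset.mem_image.1 hx
    obtain ⟨τ, hτ, rfl⟩ := Finset.mem_image.1 hy
    have h1 := Finset.mem_range.1 (Finset.mem_filter.1 hρ).1
    have h2 := Finset.mem_range.1 (Finset.mem_filter.1 hτ).1
    rw [Nat.ModEq.eq_of_lt_of_lt (((hfmod ρ).symm.trans hxy).trans (hfmod τ)) h1 h2]
  have hsub : H ⊆ Finset.range (b * (b + 3)) := by
    intro η hη
    obtain ⟨ρ, hρ, rfl⟩ := Finset.mem_image.1 hη
    have h1 := Finset.mem_range.1 (Finset.mem_filter.1 hρ).1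
    rw [Finset.mem_range]
    have : f ρ ≤ ρ + (b + 3) := by simp only [hf]; split_ifs <;> omega
    nlinarith
  refine ⟨H, hsub, ?_, ?_, ?_, ?_⟩
  · intro η hη h
    have h1 : b ∣ η + b * s := (Dvd.intro _ rfl).trans h
    exact hdvd η hη ((Nat.dvd_add_left (Dvd.intro _ rfl)).1 h1)
  · intro η hη h
    rw [hmul] at h
    obtain ⟨ρ, hρ, rfl⟩ := Finset.mem_image.1 hη
    exact (Finset.mem_filter.1 hρ).2 ((hfmod ρ).symm.trans h)
  · intro k
    by_cases hk : b ∣ k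
    · have h1 : H.filter (fun η => η ≡ k [MOD b * (b + 3)]) = ∅ := by
        apply Finset.filter_eq_empty_iff.2
        intro η hη h
        exact hdvd η hη ((Nat.ModEq.dvd_iff h (Dvd.intro _ rfl)).2 hk)
      rw [h1, Finset.card_empty, zero_add]
      apply Finset.card_le_one.2
      intro x hx y hy
      simp only [Finset.mem_filter] at hx hy
      refine heq x hx.1 y hy.1 ?_
      rw [← hmul]
      have : k + b * x ≡ k + b * y [MOD b * (b + 3)] :=
        ((Nat.modEq_zero_iff_dvd).2 hx.2).trans ((Nat.modEq_zero_iff_dvd).2 hy.2).symm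
      exact Nat.ModEq.add_left_cancel' k this
    · have h1 : H.filter (fun η => b * (b + 3) ∣ k + b * η) = ∅ := by
        apply Finset.filter_eq_empty_iff.2
        intro η hη h
        have h1 : b ∣ k + b * η := (Dvd.intro _ rfl).trans h
        exact hk ((Nat.dvd_add_left (Dvd.intro _ rfl)).1 h1)
      rw [h1, Finset.card_empty, add_zero]
      exact card_filter_mod_eq_le_one hsub k
  · rw [hH, Finset.card_image_of_injOn (hinj.mono (Finset.coe_subset.2 (Finset.filter_subset _ _))),
      Finset.filter_not]
    have h1 := Finset.le_card_sdiff
      ((Finset.range (b + 3)).filter (fun ρ => ρ ≡ s [MOD (b + 3)])) (Finset.range (b + 3))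
    have h2 := card_filter_mod_eq_le_one (le_refl (Finset.range (b + 3))) s
    rw [Finset.card_range] at h1
    omega

lemma exists_edgeSystem {b c : ℕ} (hb : 1 < b) (h : (b + 1) * b ^ 2 + c < c * b) (s : ℕ) :
    ∃ H μ, μ ≤ c ∧ IsEdgeSystem b c s μ H := by
  have hq := sq_add_two_le hb h
  have hc : 0 < c := by nlinarith
  by_cases hg : (b + 2) * (1 + Nat.gcd b c) < c
  · obtain ⟨H, hH⟩ := exists_edgeSystem_of_gcd hc hg s
    exact ⟨H, _, by nlinarith, hH⟩
  · have hgb : Nat.gcd b c ∣ b := Nat.gcd_dvd_left b c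
    obtain ⟨t, ht⟩ := hgb
    have ht1 : t = 1 := by
      by_contra hne
      have ht2 : 2 ≤ t := by
        rcases t with _ | _ | t
        · omega
        · omega
        · omega
      have : Nat.gcd b c * 2 ≤ b := by
        calc Nat.gcd b c * 2 ≤ Nat.gcd b c * t := Nat.mul_le_mul_left _ ht2
          _ = b := ht.symm
      nlinarith
    have hgb : Nat.gcd b c = b := by rw [ht1, mul_one] at ht; exact ht.symm
    rw [hgb] at hg
    obtain ⟨c', rfl⟩ : b ∣ c := by rw [← hgb]; exact Nat.gcd_dvd_right b c
    have h1 : b + 3 ≤ c' := by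
      by_contra! hlt
      have h2 : c' ≤ b + 2 := by omega
      nlinarith [Nat.mul_le_mul_left b (Nat.mul_le_mul_right (b - 1) h2),
        Nat.mul_le_mul_left b h2]
    have h2 : c' ≤ b + 3 := by
      by_contra! hlt
      rcases Nat.lt_or_ge b 3 with hb3 | hb3
      · have : b = 2 := by omega
        subst this
        omega
      · nlinarith
    have h3 : c' = b + 3 := by omega
    subst h3
    have hb4 : 4 ≤ b := by
      by_contra! hlt
      interval_cases b <;> omega
    obtain ⟨H, hH⟩ := exists_edgeSystem_of_eq hb4 s
    exact ⟨H, 1, by nlinarith, hH⟩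

/-! ### Elements excluded by a solution-free set -/

/-- If `z ∈ A` and `e = (b + 1) m - c z`, then the pairs `m - u`, `m - (e - b u)` with
`(b + 1) u ≤ e` are disjoint, and each of them contains an element outside `A`. -/
lemma div_succ_lt_card_Ioc_sdiff {b c T m z e : ℕ} (hb : 0 < b) {A : Finset ℕ}
    (hA : Avoids b c A) (hz : z ∈ A) (he : c * z + e = (b + 1) * m) (hT : T + e < m) :
    e / (b + 1) < (Finset.Ioc T m \ A).card := by
  rw [← Nat.succ_le_iff, ← Finset.card_range (Nat.succ _)]
  have hu : ∀ u ∈ Finset.range (e / (b + 1) + 1), (b + 1) * u ≤ e := by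
    intro u hu
    have h1 : u ≤ e / (b + 1) := by
      have := Finset.mem_range.1 hu
      omega
    calc (b + 1) * u ≤ (b + 1) * (e / (b + 1)) := Nat.mul_le_mul_left _ h1
      _ ≤ e := Nat.mul_div_le _ _
  have hcross : ∀ u v, (b + 1) * u ≤ e → (b + 1) * v ≤ e → u + b * v = e → u = v := by
    intro u v h1 h2 h3
    have h4 : b * u ≤ b * v := by nlinarith
    have h5 : u ≤ v := Nat.le_of_mul_le_mul_left h4 hb
    nlinarith
  apply Finset.card_le_card_of_injOn (fun u => if m - u ∈ A then m - (e - b * u) else m - u)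
  · intro u hmem
    have h1 := hu u hmem
    rw [add_mul, one_mul] at h1
    simp only [Finset.mem_coe]
    split_ifs with h
    · rw [Finset.mem_sdiff, Finset.mem_Ioc]
      refine ⟨by omega, fun hx => ?_⟩
      refine hA _ hx _ h z hz ?_
      have h2 : b * (m - u) = b * m - b * u := Nat.mul_sub _ _ _
      have h3 : b * u ≤ b * m := Nat.mul_le_mul_left _ (by omega)
      rw [add_mul, one_mul] at he
      omega
    · rw [Finset.mem_sdiff, Finset.mem_Ioc]
      exact ⟨by omega, h⟩
  · intro u hu1 v hv1 huv
    have h1 := hu u hu1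
    have h2 := hu v hv1
    have h1' := h1
    have h2' := h2
    rw [add_mul, one_mul] at h1' h2'
    simp only at huv
    split_ifs at huv with h3 h4 h4
    · have : b * u = b * v := by omega
      exact Nat.eq_of_mul_eq_mul_left hb this
    · exact (hcross v u h2 h1 (by omega)).symm
    · exact hcross u v h1 h2 (by omega)
    · omega

/-- Every `z ∈ D` and `η ∈ H` give a solution `x + b y = c z` with `y ≡ η` and `x ≡ -b η` modulo
`c`, and with `x`, `y` within a bounded distance of `c z / (b + 1)`. Double counting the pairs
`(z, η)` against the element outside `A` that each of them provides bounds `D`. -/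
lemma card_mul_card_le {b c s μ l n : ℕ} {A D H K : Finset ℕ} (hc : 0 < c)
    (hA : Avoids b c A) (hH : IsEdgeSystem b c s μ H) (hD : D ⊆ A)
    (hlo : ∀ z ∈ D, l + c * b < c * (z / (b + 1)))
    (hhi : ∀ z ∈ D, c * (z / (b + 1) + b + 1) ≤ n)
    (hK : ∀ k, l < k → k ≤ n → k ∉ A → ¬ c ∣ k + b * s → k ∈ K) :
    D.card * H.card ≤ (b + 1) * μ * K.card := by
  classical
  obtain ⟨hHsub, hH1, hH2, hH3, -⟩ := hH
  set Y : ℕ × ℕ → ℕ := fun p => c * (p.1 / (b + 1)) + p.2 with hY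
  set X : ℕ × ℕ → ℕ := fun p => c * (p.1 / (b + 1) + p.1 % (b + 1)) - b * p.2 with hX
  have hXe : ∀ p ∈ D ×ˢ H, X p + b * p.2 = c * (p.1 / (b + 1) + p.1 % (b + 1)) ∧ l < X p ∧
      X p ≤ n ∧ l < Y p ∧ Y p ≤ n := by
    intro p hp
    obtain ⟨hz, hη⟩ := Finset.mem_product.1 hp
    have h1 := Finset.mem_range.1 (hHsub hη)
    have h2 := hlo _ hz
    have h3 := hhi _ hz
    have h4 : p.1 % (b + 1) ≤ b := Nat.lt_succ_iff.1 (Nat.mod_lt _ (Nat.succ_pos b))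
    have h5 : b * p.2 ≤ c * b := by rw [mul_comm c]; exact Nat.mul_le_mul_left _ h1.le
    have h6 : c * (p.1 % (b + 1)) ≤ c * b := Nat.mul_le_mul_left _ h4
    simp only [mul_add, mul_one] at h2 h3
    have eX : X p = c * (p.1 / (b + 1) + p.1 % (b + 1)) - b * p.2 := rfl
    have eY : Y p = c * (p.1 / (b + 1)) + p.2 := rfl
    rw [eX, eY, mul_add]
    refine ⟨by omega, by omega, by omega, by omega, by omega⟩
  rw [← Finset.card_product]
  refine Finset.card_le_mul_card_image_of_maps_to
    (f := fun p => if Y p ∈ A then X p else Y p) (t := K) ?_ _ ?_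
  · intro p hp
    obtain ⟨h1, h2, h3, h4, h5⟩ := hXe p hp
    obtain ⟨hz, hη⟩ := Finset.mem_product.1 hp
    split_ifs with h
    · refine hK _ h2 h3 (fun hx => hA _ hx _ h _ (hD hz) ?_) ?_
      · have h6 := Nat.div_add_mod p.1 (b + 1)
        calc X p + b * Y p = (X p + b * p.2) + b * (c * (p.1 / (b + 1))) := by
              simp only [hY]; ring
          _ = c * ((b + 1) * (p.1 / (b + 1)) + p.1 % (b + 1)) := by rw [h1]; ring
          _ = c * p.1 := by rw [h6]
      · intro hd
        refine hH2 _ hη (Nat.ModEq.add_left_cancel' (X p) ?_)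
        rw [h1]
        exact ((Nat.modEq_zero_iff_dvd).2 (Dvd.intro _ rfl)).trans
          ((Nat.modEq_zero_iff_dvd).2 hd).symm
    · refine hK _ h4 h5 h ?_
      intro hd
      simp only [hY, add_assoc] at hd
      exact hH1 _ hη ((Nat.dvd_add_right (Dvd.intro _ rfl)).1 hd)
  · intro k _
    have hsub : (D ×ˢ H).filter (fun p => (if Y p ∈ A then X p else Y p) = k) ⊆
        (D ×ˢ H).filter (fun p => Y p = k) ∪ (D ×ˢ H).filter (fun p => X p = k) := by
      intro p hp
      simp only [Finset.mem_union, Finset.mem_filter] at hp ⊢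
      obtain ⟨h1, h2⟩ := hp
      split_ifs at h2 <;> tauto
    have hYk : ((D ×ˢ H).filter (fun p => Y p = k)).card ≤
        (b + 1) * (H.filter (fun η => η ≡ k [MOD c])).card := by
      rw [← Finset.card_range (b + 1), ← Finset.card_product]
      apply Finset.card_le_card_of_injOn (fun p => (p.1 % (b + 1), p.2))
      · intro p hp
        simp only [Finset.coe_filter, Set.mem_ofPred_eq, Finset.mem_product] at hp
        simp only [Finset.coe_product, Set.mem_prod, Finset.mem_coe, Finset.mem_range,
          Finset.mem_filter]
        refine ⟨Nat.mod_lt _ (Nat.succ_pos b), hp.1.2, ?_⟩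
        rw [← hp.2]
        simp only [hY]
        exact (Nat.mul_add_mod c (p.1 / (b + 1)) p.2).symm
      · intro p hp q hq hpq
        simp only [Finset.coe_filter, Set.mem_ofPred_eq, Finset.mem_product] at hp hq
        obtain ⟨h1, h2⟩ := Prod.mk.inj hpq
        have h3 : c * (p.1 / (b + 1)) = c * (q.1 / (b + 1)) := by
          have h3 := hp.2.trans hq.2.symm
          simp only [hY] at h3
          omega
        have h4 := Nat.eq_of_mul_eq_mul_left hc h3
        have h5 := Nat.div_add_mod p.1 (b + 1)
        have h6 := Nat.div_add_mod q.1 (b + 1)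
        refine Prod.ext ?_ h2
        rw [← h5, ← h6, h4, h1]
    have hXk : ((D ×ˢ H).filter (fun p => X p = k)).card ≤
        (b + 1) * (H.filter (fun η => c ∣ k + b * η)).card := by
      rw [← Finset.card_range (b + 1), ← Finset.card_product]
      apply Finset.card_le_card_of_injOn (fun p => (p.1 % (b + 1), p.2))
      · intro p hp
        simp only [Finset.coe_filter, Set.mem_ofPred_eq] at hp
        have h1 := (hXe p hp.1).1
        simp only [Finset.coe_product, Set.mem_prod, Finset.mem_coe, Finset.mem_range,
          Finset.mem_filter]
        refine ⟨Nat.mod_lt _ (Nat.succ_pos b), (Finset.mem_product.1 hp.1).2, ?_⟩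
        rw [← hp.2, h1]
        exact Dvd.intro _ rfl
      · intro p hp q hq hpq
        simp only [Finset.coe_filter, Set.mem_ofPred_eq] at hp hq
        obtain ⟨h1, h2⟩ := Prod.mk.inj hpq
        have hp1 := (hXe p hp.1).1
        have hq1 := (hXe q hq.1).1
        rw [hp.2] at hp1
        rw [hq.2, ← h2, hp1] at hq1
        have h4 := Nat.eq_of_mul_eq_mul_left hc hq1
        have h5 := Nat.div_add_mod p.1 (b + 1)
        have h6 := Nat.div_add_mod q.1 (b + 1)
        refine Prod.ext ?_ h2
        have h7 : p.1 / (b + 1) = q.1 / (b + 1) := by omega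
        rw [← h5, ← h6, h7, h1]
    calc _ ≤ _ := (Finset.card_le_card hsub).trans (Finset.card_union_le _ _)
      _ ≤ _ := add_le_add hYk hXk
      _ ≤ _ := by rw [← mul_add]; exact Nat.mul_le_mul_left _ (hH3 k)

/-- A single `z ∈ A` well inside the range excludes many elements. -/
lemma le_two_mul_card {b c s μ l n z M : ℕ} {A H K : Finset ℕ} (hb : 0 < b) (hc : 0 < c)
    (hA : Avoids b c A) (hH : IsEdgeSystem b c s μ H) (hz : z ∈ A)
    (hlo : l + c * b * M < c * (z / (b + 1))) (hhi : c * (z / (b + 1) + M + b + 1) ≤ n)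
    (hK : ∀ k, l < k → k ≤ n → k ∉ A → ¬ c ∣ k + b * s → k ∈ K) :
    M ≤ 2 * K.card := by
  classical
  obtain ⟨hHsub, hH1, hH2, hH3, hH4⟩ := hH
  obtain ⟨η, hη⟩ : H.Nonempty := Finset.card_pos.1 (by omega)
  have hηc := Finset.mem_range.1 (hHsub hη)
  set m := z / (b + 1) with hm
  set i := z % (b + 1) with hi
  have hz' : (b + 1) * m + i = z := Nat.div_add_mod z (b + 1)
  have hib : i ≤ b := Nat.lt_succ_iff.1 (Nat.mod_lt _ (Nat.succ_pos b))
  set Y : ℕ → ℕ := fun a => c * (m + a) + η with hY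
  set X : ℕ → ℕ := fun a => c * (m + i) - b * (c * a + η) with hX
  have hXe : ∀ a ∈ Finset.range M, X a + b * (c * a + η) = c * (m + i) ∧ l < X a ∧ X a ≤ n ∧
      l < Y a ∧ Y a ≤ n := by
    intro a ha
    have ha' := Finset.mem_range.1 ha
    have h1 : b * (c * a + η) ≤ c * b * M := by
      calc b * (c * a + η) ≤ b * (c * a + c) := by gcongr
        _ = c * b * (a + 1) := by ring
        _ ≤ c * b * M := Nat.mul_le_mul_left _ ha'
    have h2 : c * i ≤ c * b := Nat.mul_le_mul_left _ hib
    have h3 : c * a ≤ c * M := Nat.mul_le_mul_left _ ha'.le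
    simp only [mul_add c, mul_one] at hhi
    have eX : X a = c * (m + i) - b * (c * a + η) := rfl
    have eY : Y a = c * (m + a) + η := rfl
    rw [eX, eY, mul_add c, mul_add c]
    refine ⟨by omega, by omega, by omega, by omega, by omega⟩
  rw [← Finset.card_range M]
  refine Finset.card_le_mul_card_image_of_maps_to
    (f := fun a => if Y a ∈ A then X a else Y a) (t := K) ?_ _ ?_
  · intro a ha
    obtain ⟨h1, h2, h3, h4, h5⟩ := hXe a ha
    split_ifs with h
    · refine hK _ h2 h3 (fun hx => hA _ hx _ h _ hz ?_) ?_
      · calc X a + b * Y a = (X a + b * (c * a + η)) + b * (c * m) := by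
              simp only [hY]; ring
          _ = c * ((b + 1) * m + i) := by rw [h1]; ring
          _ = c * z := by rw [hz']
      · intro hd
        refine hH2 _ hη ?_
        have h6 : b * (c * a + η) ≡ b * η [MOD c] :=
          Nat.ModEq.mul_left _ (Nat.mul_add_mod c a η)
        refine h6.symm.trans (Nat.ModEq.add_left_cancel' (X a) ?_)
        rw [h1]
        exact ((Nat.modEq_zero_iff_dvd).2 (Dvd.intro _ rfl)).trans
          ((Nat.modEq_zero_iff_dvd).2 hd).symm
    · refine hK _ h4 h5 h ?_
      intro hd
      simp only [hY, add_assoc] at hd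
      exact hH1 _ hη ((Nat.dvd_add_right (Dvd.intro _ rfl)).1 hd)
  · intro k _
    have hsub : (Finset.range M).filter (fun a => (if Y a ∈ A then X a else Y a) = k) ⊆
        (Finset.range M).filter (fun a => Y a = k) ∪
          (Finset.range M).filter (fun a => X a = k) := by
      intro a ha
      simp only [Finset.mem_union, Finset.mem_filter] at ha ⊢
      obtain ⟨h1, h2⟩ := ha
      split_ifs at h2 <;> tauto
    have h1 : ((Finset.range M).filter (fun a => Y a = k)).card ≤ 1 := by
      apply Finset.card_le_one.2
      intro x hx y hy
      simp only [Finset.mem_filter, hY] at hx hy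
      have : c * (m + x) = c * (m + y) := by omega
      have := Nat.eq_of_mul_eq_mul_left hc this
      omega
    have h2 : ((Finset.range M).filter (fun a => X a = k)).card ≤ 1 := by
      apply Finset.card_le_one.2
      intro x hx y hy
      simp only [Finset.mem_filter] at hx hy
      have hx1 := (hXe x hx.1).1
      have hy1 := (hXe y hy.1).1
      have h3 : b * (c * x + η) = b * (c * y + η) := by omega
      have h4 := Nat.eq_of_mul_eq_mul_left hb h3
      exact Nat.eq_of_mul_eq_mul_left hc (by omega : c * x = c * y)
    calc _ ≤ _ := (Finset.card_le_card hsub).trans (Finset.card_union_le _ _)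
      _ ≤ 1 + 1 := add_le_add h1 h2

/-! ### The elements between the two blocks -/

/-- A bounded number of excluded elements, more than the estimates for `(cut, l₁]` can lose. -/
def slack (b c : ℕ) : ℕ := 2 * ((b + 1) ^ 2 * ((b + 1) * c + 1)) + 2

/-- The threshold, about `(b + 1) l₁ / c`, that separates the elements `z` played against the
least element of the set from those played against pairs of elements near `c z / (b + 1)`. -/
def cut (b c n : ℕ) : ℕ := (b + 1) * l₁ b c n / c + (b + (b + 1) * (b * slack b c))

/-- A bound from which on the estimates for the middle range are valid. -/
def threshold (b c : ℕ) : ℕ :=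
  c ^ 2 * ((b + (b + 1) * (b * slack b c)) + (b + 1) * (slack b c + b + 2))

/-- The elements of `(l₁, n]` missing from `A`. -/
def missing (b c n : ℕ) (A : Finset ℕ) : Finset ℕ := Finset.Ioc (l₁ b c n) n \ A

/-- The missing elements that can be of the form `c z - b s` with `z ≤ cut`. -/
def missingLow (b c n s : ℕ) (A : Finset ℕ) : Finset ℕ :=
  (missing b c n A).filter (fun k => k ≤ c * cut b c n ∧ c ∣ k + b * s)

/-- The missing elements not counted in `missingLow`. -/
def missingHigh (b c n s : ℕ) (A : Finset ℕ) : Finset ℕ :=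
  (missing b c n A).filter (fun k => ¬ (k ≤ c * cut b c n ∧ c ∣ k + b * s))

lemma mul_l₁_le (b c n : ℕ) : c * l₁ b c n ≤ (b + 1) * n := Nat.mul_div_le _ _

lemma lt_mul_l₁_add {b c n : ℕ} (hc : 0 < c) : (b + 1) * n < c * l₁ b c n + c := by
  have := Nat.lt_mul_div_succ ((b + 1) * n) hc
  rwa [mul_add, mul_one] at this

lemma mul_r₂_le (b c n s : ℕ) : c * r₂ b c n s ≤ l₁ b c n + b * s := Nat.mul_div_le _ _

lemma lt_mul_r₂_add {b c n s : ℕ} (hc : 0 < c) :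
    l₁ b c n + b * s < c * r₂ b c n s + c := by
  have := Nat.lt_mul_div_succ (l₁ b c n + b * s) hc
  rwa [mul_add, mul_one] at this

lemma mul_l₂_le (b c n s : ℕ) : c * l₂ b c n s ≤ (b + 1) * r₂ b c n s := Nat.mul_div_le _ _

lemma lt_mul_l₂_add {b c n s : ℕ} (hc : 0 < c) :
    (b + 1) * r₂ b c n s < c * l₂ b c n s + c := by
  have := Nat.lt_mul_div_succ ((b + 1) * r₂ b c n s) hc
  rwa [mul_add, mul_one] at this

lemma mul_cut_add_le {b c n : ℕ} (hq : (b + 1) ^ 2 + 2 ≤ c) (hn : threshold b c ≤ n) :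
    c * cut b c n + c * (b + 1) * (slack b c + b + 2) ≤ n := by
  have hc : 0 < c := by omega
  have h1 := mul_l₁_le b c n
  have h2 : c * ((b + 1) * l₁ b c n / c) ≤ (b + 1) * l₁ b c n := Nat.mul_div_le _ _
  refine Nat.le_of_mul_le_mul_left ?_ hc
  rw [threshold] at hn
  rw [cut]
  generalize b + (b + 1) * (b * slack b c) = C at *
  generalize (b + 1) * l₁ b c n / c = q at *
  have h3 : c * (c * q) ≤ (b + 1) * ((b + 1) * n) :=
    calc c * (c * q) ≤ c * ((b + 1) * l₁ b c n) := Nat.mul_le_mul_left _ h2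
      _ = (b + 1) * (c * l₁ b c n) := by ring
      _ ≤ _ := Nat.mul_le_mul_left _ h1
  have h4 : ((b + 1) ^ 2 + 1) * n ≤ c * n := Nat.mul_le_mul_right _ (by omega)
  calc c * (c * (q + C) + c * (b + 1) * (slack b c + b + 2))
      = c * (c * q) + c ^ 2 * (C + (b + 1) * (slack b c + b + 2)) := by ring
    _ ≤ (b + 1) * ((b + 1) * n) + n := add_le_add h3 hn
    _ = ((b + 1) ^ 2 + 1) * n := by ring
    _ ≤ _ := h4

lemma l₁_lt_mul_cut {b c n : ℕ} (hb : 0 < b) (hc : 0 < c) : l₁ b c n < c * cut b c n := by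
  have h1 := Nat.lt_mul_div_succ ((b + 1) * l₁ b c n) hc
  rw [cut, mul_add]
  have h2 : c ≤ c * (b + (b + 1) * (b * slack b c)) := Nat.le_mul_of_pos_right _ (by omega)
  rw [mul_add, mul_one, add_mul, one_mul] at h1
  rw [add_mul, one_mul]
  omega

lemma lt_mul_div_of_cut_lt {b c n z : ℕ} (hc : 0 < c) (hz : cut b c n < z) :
    l₁ b c n + c * b * slack b c < c * (z / (b + 1)) := by
  have h1 := Nat.lt_mul_div_succ ((b + 1) * l₁ b c n) hc
  rw [cut] at hz
  have h2 := Nat.lt_mul_div_succ z (Nat.succ_pos b)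
  rw [mul_add, Nat.succ_eq_add_one] at h2
  refine Nat.lt_of_mul_lt_mul_left (a := b + 1) ?_
  have h3 : (b + 1) * l₁ b c n / c + 1 + (b + 1) * (b * slack b c) ≤ (b + 1) * (z / (b + 1)) := by
    omega
  calc (b + 1) * (l₁ b c n + c * b * slack b c)
      = (b + 1) * l₁ b c n + c * ((b + 1) * (b * slack b c)) := by ring
    _ < c * ((b + 1) * l₁ b c n / c + 1) + c * ((b + 1) * (b * slack b c)) := by omega
    _ = c * ((b + 1) * l₁ b c n / c + 1 + (b + 1) * (b * slack b c)) := by ring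
    _ ≤ c * ((b + 1) * (z / (b + 1))) := Nat.mul_le_mul_left _ h3
    _ = _ := by ring

/-- Elements of `(r₂, cut]` are outweighed by the missing elements `c z - b s`. -/
lemma card_inter_Ioc_cut_le {b c n s : ℕ} {A : Finset ℕ} (hq : (b + 1) ^ 2 + 2 ≤ c)
    (hn : threshold b c ≤ n) (hA : Avoids b c A) (hs : s ∈ A) :
    (A ∩ Finset.Ioc (r₂ b c n s) (cut b c n)).card ≤ (missingLow b c n s A).card := by
  have hc : 0 < c := by omega
  have hcut := mul_cut_add_le hq hn
  have hbd : ∀ z ∈ A ∩ Finset.Ioc (r₂ b c n s) (cut b c n),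
      z ∈ A ∧ l₁ b c n + b * s < c * z ∧ c * z ≤ c * cut b c n := by
    intro z hz
    rw [Finset.mem_inter, Finset.mem_Ioc] at hz
    refine ⟨hz.1, ?_, Nat.mul_le_mul_left _ hz.2.2⟩
    calc _ < c * r₂ b c n s + c := lt_mul_r₂_add hc
      _ = c * (r₂ b c n s + 1) := by ring
      _ ≤ c * z := Nat.mul_le_mul_left _ hz.2.1
  apply Finset.card_le_card_of_injOn (fun z => c * z - b * s)
  · intro z hz
    obtain ⟨h1, h2, h3⟩ := hbd z hz
    simp only [missingLow, missing, Finset.coe_filter, Set.mem_ofPred_eq, Finset.mem_sdiff,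
      Finset.mem_Ioc]
    refine ⟨⟨⟨by omega, by omega⟩, fun hx => hA _ hx s hs z h1 (by omega)⟩, by omega, ?_⟩
    rw [Nat.sub_add_cancel (by omega)]
    exact Dvd.intro _ rfl
  · intro z hz w hw hzw
    obtain ⟨h1, h2, h3⟩ := hbd z hz
    obtain ⟨h4, h5, h6⟩ := hbd w hw
    simp only at hzw
    exact Nat.eq_of_mul_eq_mul_left hc (by omega)

/-- Unless `l₁` is the only element of `A` in `(cut, l₁]`, the elements of `A` there are strictly
outweighed by missing elements other than those used in `card_inter_Ioc_cut_le`. -/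
lemma forall_eq_l₁_or_card_lt {b c n s : ℕ} {A : Finset ℕ} (hb : 1 < b)
    (hbc : (b + 1) * b ^ 2 + c < c * b) (hn : threshold b c ≤ n) (hA : Avoids b c A) :
    (∀ z ∈ A, cut b c n < z → z ≤ l₁ b c n → z = l₁ b c n) ∨
      (A ∩ Finset.Ioc (cut b c n) (l₁ b c n)).card < (missingHigh b c n s A).card := by
  have hq := sq_add_two_le hb hbc
  have hc : 0 < c := by omega
  have hcut := mul_cut_add_le hq hn
  have hl := mul_l₁_le b c n
  have hlcut := l₁_lt_mul_cut (n := n) (by omega : 0 < b) hc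
  have hM1 : 1 ≤ slack b c := by rw [slack]; omega
  rw [or_iff_not_imp_left]
  intro hne
  push Not at hne
  obtain ⟨w, hwA, hw1, hw2, hw3⟩ := hne
  set D := A ∩ Finset.Ioc (cut b c n) (l₁ b c n) with hD
  set K := missingHigh b c n s A with hKdef
  have hDne : D.Nonempty := ⟨w, by rw [hD, Finset.mem_inter, Finset.mem_Ioc]; exact ⟨hwA, hw1, hw2⟩⟩
  obtain ⟨z, hzD, hzmin⟩ := D.exists_min_image id hDne
  simp only [id] at hzmin
  have hzD' := hzD
  rw [hD, Finset.mem_inter, Finset.mem_Ioc] at hzD'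
  obtain ⟨hzA, hz1, hz2⟩ := hzD'
  have hzl : z < l₁ b c n := by
    have := hzmin w (by rw [hD, Finset.mem_inter, Finset.mem_Ioc]; exact ⟨hwA, hw1, hw2⟩)
    omega
  have hczl : c * z ≤ c * l₁ b c n := Nat.mul_le_mul_left _ hz2
  obtain ⟨e, he⟩ : ∃ e, c * z + e = (b + 1) * n := ⟨(b + 1) * n - c * z, by omega⟩
  -- `z` is the least element; if it is near `l₁`, the pairs it excludes outnumber `[z, l₁]`
  by_cases hcase : c * cut b c n + e < n
  · have h1 := div_succ_lt_card_Ioc_sdiff (by omega) hA hzA he hcase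
    have h2 : (Finset.Ioc (c * cut b c n) n \ A).card ≤ K.card := by
      apply Finset.card_le_card
      intro k hk
      rw [Finset.mem_sdiff, Finset.mem_Ioc] at hk
      simp only [hKdef, missingHigh, missing, Finset.mem_filter, Finset.mem_sdiff, Finset.mem_Ioc]
      exact ⟨⟨⟨by omega, hk.1.2⟩, hk.2⟩, by omega⟩
    have h3 : D.card ≤ l₁ b c n - z + 1 := by
      have : D ⊆ Finset.Icc z (l₁ b c n) := by
        intro x hx
        have h4 := hzmin x hx
        rw [hD, Finset.mem_inter, Finset.mem_Ioc] at hx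
        exact Finset.mem_Icc.2 ⟨h4, hx.2.2⟩
      have := Finset.card_le_card this
      rw [Nat.card_Icc] at this
      omega
    obtain ⟨δ, hδ⟩ : ∃ δ, l₁ b c n = z + δ := ⟨l₁ b c n - z, by omega⟩
    have h4 : (b + 1) * δ ≤ e / (b + 1) := by
      rw [Nat.le_div_iff_mul_le (Nat.succ_pos b)]
      have h5 : c * δ ≤ e := by
        rw [hδ, mul_add] at hl
        omega
      calc (b + 1) * δ * (b + 1) = (b + 1) ^ 2 * δ := by ring
        _ ≤ c * δ := Nat.mul_le_mul_right _ (by omega)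
        _ ≤ e := h5
    have h5 : 2 * δ ≤ (b + 1) * δ := Nat.mul_le_mul_right _ (by omega)
    omega
  · by_contra! hlt
    obtain ⟨H, μ, hμ, hH⟩ := exists_edgeSystem hb hbc s
    have hK : ∀ k, l₁ b c n < k → k ≤ n → k ∉ A → ¬ c ∣ k + b * s → k ∈ K := by
      intro k h1 h2 h3 h4
      simp only [hKdef, missingHigh, missing, Finset.mem_filter, Finset.mem_sdiff, Finset.mem_Ioc]
      exact ⟨⟨⟨h1, h2⟩, h3⟩, fun h => h4 h.2⟩
    -- all but `(b + 1)²` elements enter the double counting, whose gain by a constant factor makes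
    -- up for the rest, as `z` alone excludes many elements
    set D₁ := D.filter (fun z => z + (b + 1) ^ 2 ≤ l₁ b c n) with hD₁
    have hD₂ : (D.filter (fun z => ¬ z + (b + 1) ^ 2 ≤ l₁ b c n)).card ≤ (b + 1) ^ 2 := by
      have : D.filter (fun z => ¬ z + (b + 1) ^ 2 ≤ l₁ b c n) ⊆
          Finset.Ioc (l₁ b c n - (b + 1) ^ 2) (l₁ b c n) := by
        intro x hx
        rw [Finset.mem_filter, hD, Finset.mem_inter, Finset.mem_Ioc] at hx
        rw [Finset.mem_Ioc]
        omega
      have := Finset.card_le_card this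
      rw [Nat.card_Ioc] at this
      omega
    have hDcard := Finset.card_filter_add_card_filter_not (s := D)
      (fun z => z + (b + 1) ^ 2 ≤ l₁ b c n)
    rw [← hD₁] at hDcard
    have hmain := card_mul_card_le (l := l₁ b c n) (n := n) (D := D₁) (K := K) hc hA hH
      (fun x hx => (Finset.mem_inter.1 (Finset.mem_filter.1 hx).1).1)
      (by
        intro x hx
        have hx1 := (Finset.mem_filter.1 hx).1
        rw [hD, Finset.mem_inter, Finset.mem_Ioc] at hx1
        have h1 := lt_mul_div_of_cut_lt hc hx1.2.1
        have h2 : c * b ≤ c * b * slack b c := Nat.le_mul_of_pos_right _ hM1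
        omega)
      (by
        intro x hx
        have hx1 := (Finset.mem_filter.1 hx).2
        have h1 := Nat.mul_div_le x (b + 1)
        refine le_of_mul_le_mul_left ?_ (Nat.succ_pos b)
        calc (b + 1) * (c * (x / (b + 1) + b + 1))
            = c * ((b + 1) * (x / (b + 1)) + (b + 1) ^ 2) := by ring
          _ ≤ c * l₁ b c n := Nat.mul_le_mul_left _ (by omega)
          _ ≤ _ := hl)
      hK
    have hmany := le_two_mul_card (l := l₁ b c n) (n := n) (z := z) (M := slack b c) (K := K)
      (by omega) hc hA hH hzA (lt_mul_div_of_cut_lt hc hz1)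
      (by
        have h1 := Nat.mul_le_mul_left c (Nat.mul_div_le z (b + 1))
        refine le_of_mul_le_mul_left ?_ (Nat.succ_pos b)
        have h2 : c * (b + 1) * (slack b c + b + 2) =
          c * (b + 1) * (slack b c + b + 1) + c * (b + 1) := by ring
        have h3 : (b + 1) * (c * (z / (b + 1) + slack b c + b + 1)) =
          c * ((b + 1) * (z / (b + 1))) + c * (b + 1) * (slack b c + b + 1) := by ring
        have h4 : (b + 1) * n = b * n + n := by ring
        rw [Nat.succ_eq_add_one, h3]
        omega)
      hK
    have hH5 : (b + 1) * μ + 1 ≤ H.card := hH.2.2.2.2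
    have h1 : D₁.card * ((b + 1) * μ + 1) ≤ (b + 1) * μ * (D₁.card + (b + 1) ^ 2) :=
      calc _ ≤ D₁.card * H.card := Nat.mul_le_mul_left _ hH5
        _ ≤ _ := hmain
        _ ≤ _ := Nat.mul_le_mul_left _ (by omega)
    have h2 : D₁.card ≤ (b + 1) * μ * (b + 1) ^ 2 := by
      rw [mul_add, mul_one, mul_add, mul_comm D₁.card] at h1
      omega
    have h3 : (b + 1) * μ * (b + 1) ^ 2 ≤ (b + 1) * c * (b + 1) ^ 2 :=
      Nat.mul_le_mul_right _ (Nat.mul_le_mul_left _ hμ)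
    have h4 : (b + 1) ^ 2 * ((b + 1) * c + 1) = (b + 1) * c * (b + 1) ^ 2 + (b + 1) ^ 2 := by ring
    rw [slack, h4] at hmany
    omega

lemma card_missingLow_add (b c n s : ℕ) (A : Finset ℕ) :
    (missingLow b c n s A).card + (missingHigh b c n s A).card = (missing b c n A).card :=
  Finset.card_filter_add_card_filter_not _

/-- If `l₁ ∈ A` then one of `n` and `n - ((b + 1) n - c l₁)` is missing. -/
lemma exists_mem_missingHigh {b c n s ξ : ℕ} {A : Finset ℕ} (hb : 0 < b)
    (hq : (b + 1) ^ 2 + 2 ≤ c) (hn : threshold b c ≤ n) (hA : Avoids b c A)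
    (hl : l₁ b c n ∈ A) (hξ : c * l₁ b c n + ξ = (b + 1) * n) :
    ξ < c ∧ c * cut b c n < n - ξ ∧
      (n ∈ missingHigh b c n s A ∨ n - ξ ∈ missingHigh b c n s A) := by
  have hc : 0 < c := by omega
  have hcut := mul_cut_add_le hq hn
  have hξc : ξ < c := by
    have := lt_mul_l₁_add (b := b) (n := n) hc
    omega
  have h1 : c ≤ c * (b + 1) * (slack b c + b + 2) := by
    rw [mul_assoc]
    exact Nat.le_mul_of_pos_right _ (by positivity)
  have h2 := l₁_lt_mul_cut (n := n) hb hc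
  refine ⟨hξc, by omega, ?_⟩
  simp only [missingHigh, missing, Finset.mem_filter, Finset.mem_sdiff, Finset.mem_Ioc]
  by_cases hnA : n ∈ A
  · right
    refine ⟨⟨by omega, fun hx => hA _ hx n hnA _ hl ?_⟩, by omega⟩
    rw [add_mul, one_mul] at hξ
    omega
  · left
    exact ⟨⟨by omega, hnA⟩, by omega⟩

/-- The elements of `A` between the blocks are outweighed by the missing elements of the upper
block; in case of equality `(cut, l₁]` contains at most `l₁`. -/
lemma card_inter_Ioc_le {b c n s : ℕ} {A : Finset ℕ} (hb : 1 < b)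
    (hbc : (b + 1) * b ^ 2 + c < c * b) (hn : threshold b c ≤ n) (hA : Avoids b c A)
    (hs : s ∈ A) :
    (A ∩ Finset.Ioc (r₂ b c n s) (l₁ b c n)).card ≤ (missing b c n A).card ∧
    ((missing b c n A).card ≤ (A ∩ Finset.Ioc (r₂ b c n s) (l₁ b c n)).card →
      (∀ z ∈ A, cut b c n < z → z ≤ l₁ b c n → z = l₁ b c n) ∧
      (missingHigh b c n s A).card ≤ 1) := by
  have hq := sq_add_two_le hb hbc
  have h1 := card_inter_Ioc_cut_le hq hn hA hs
  have h2 := forall_eq_l₁_or_card_lt (s := s) hb hbc hn hA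
  have h3 := card_missingLow_add b c n s A
  have h4 : (A ∩ Finset.Ioc (r₂ b c n s) (l₁ b c n)).card ≤
      (A ∩ Finset.Ioc (r₂ b c n s) (cut b c n)).card +
        (A ∩ Finset.Ioc (cut b c n) (l₁ b c n)).card := by
    refine le_trans (Finset.card_le_card ?_) (Finset.card_union_le _ _)
    intro x hx
    simp only [Finset.mem_inter, Finset.mem_union, Finset.mem_Ioc] at hx ⊢
    by_cases h : x ≤ cut b c n
    · exact Or.inl ⟨hx.1, hx.2.1, h⟩
    · exact Or.inr ⟨hx.1, by omega, hx.2.2⟩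
  have h5 : (∀ z ∈ A, cut b c n < z → z ≤ l₁ b c n → z = l₁ b c n) →
      (A ∩ Finset.Ioc (cut b c n) (l₁ b c n)).card ≤ 1 ∧
      (A ∩ Finset.Ioc (cut b c n) (l₁ b c n)).card ≤ (missingHigh b c n s A).card := by
    intro h
    have hsub : A ∩ Finset.Ioc (cut b c n) (l₁ b c n) ⊆ {l₁ b c n} := by
      intro x hx
      rw [Finset.mem_inter, Finset.mem_Ioc] at hx
      exact Finset.mem_singleton.2 (h x hx.1 hx.2.1 hx.2.2)
    refine ⟨Finset.card_le_card hsub, ?_⟩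
    rcases Finset.eq_empty_or_nonempty (A ∩ Finset.Ioc (cut b c n) (l₁ b c n)) with h0 | ⟨x, hx⟩
    · rw [h0]; simp
    · have hxl := Finset.mem_singleton.1 (hsub hx)
      subst hxl
      have hl := (Finset.mem_inter.1 hx).1
      obtain ⟨-, -, h6⟩ := exists_mem_missingHigh (s := s) (ξ := (b + 1) * n - c * l₁ b c n)
        (by omega) hq hn hA hl (by have := mul_l₁_le b c n; omega)
      have h7 : 0 < (missingHigh b c n s A).card := by
        rcases h6 with h6 | h6
        · exact Finset.card_pos.2 ⟨_, h6⟩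
        · exact Finset.card_pos.2 ⟨_, h6⟩
      have := Finset.card_le_card hsub
      rw [Finset.card_singleton] at this
      omega
  constructor
  · rcases h2 with h2 | h2
    · have := h5 h2
      omega
    · omega
  · intro hle
    rcases h2 with h2 | h2
    · have := h5 h2
      exact ⟨h2, by omega⟩
    · omega

lemma card_add_card_missing_le (b c s : ℕ) {n : ℕ} {A : Finset ℕ}
    (hAn : A ⊆ Finset.Icc 1 n) :
    A.card + (missing b c n A).card ≤ (A ∩ Finset.Iic (r₂ b c n s)).card +
      (A ∩ Finset.Ioc (r₂ b c n s) (l₁ b c n)).card + (n - l₁ b c n) := by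
  have h1 : A.card ≤ (A ∩ Finset.Iic (r₂ b c n s)).card +
      (A ∩ Finset.Ioc (r₂ b c n s) (l₁ b c n)).card + (A ∩ Finset.Ioc (l₁ b c n) n).card := by
    have hsub : A ⊆ (A ∩ Finset.Iic (r₂ b c n s) ∪ A ∩ Finset.Ioc (r₂ b c n s) (l₁ b c n)) ∪
        A ∩ Finset.Ioc (l₁ b c n) n := by
      intro x hx
      have := Finset.mem_Icc.1 (hAn hx)
      simp only [Finset.mem_union, Finset.mem_inter, Finset.mem_Iic, Finset.mem_Ioc, hx, true_and]
      omega
    refine (Finset.card_le_card hsub).trans ((Finset.card_union_le _ _).trans ?_)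
    exact Nat.add_le_add_right (Finset.card_union_le _ _) _
  have h2 : (missing b c n A).card + (A ∩ Finset.Ioc (l₁ b c n) n).card = n - l₁ b c n := by
    rw [missing, Finset.inter_comm, Finset.card_sdiff_add_card_inter, Nat.card_Ioc]
  omega

/-! ### Comparison sets -/

lemma l₁_le {b c n : ℕ} (hq : (b + 1) ^ 2 + 2 ≤ c) : l₁ b c n ≤ n := by
  have h1 := mul_l₁_le b c n
  refine le_of_mul_le_mul_left ?_ (by omega : 0 < c)
  exact h1.trans (Nat.mul_le_mul_right _ (by nlinarith))

lemma r₂_le_l₁ {b c n s : ℕ} (hq : (b + 1) ^ 2 + 2 ≤ c) (hs : s ≤ l₁ b c n) :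
    r₂ b c n s ≤ l₁ b c n := by
  have h1 := mul_r₂_le b c n s
  refine le_of_mul_le_mul_left ?_ (by omega : 0 < c)
  calc c * r₂ b c n s ≤ l₁ b c n + b * l₁ b c n := h1.trans (by gcongr)
    _ = (b + 1) * l₁ b c n := by ring
    _ ≤ _ := Nat.mul_le_mul_right _ (by nlinarith)

lemma r₂_mono {b c n s t : ℕ} (hst : s ≤ t) : r₂ b c n s ≤ r₂ b c n t := by
  unfold r₂
  gcongr

lemma l₂_mono {b c n s t : ℕ} (hst : s ≤ t) : l₂ b c n s ≤ l₂ b c n t := by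
  unfold l₂
  have := r₂_mono (b := b) (c := c) (n := n) hst
  gcongr

lemma l₂_succ_lt {b c n t : ℕ} (hq : (b + 1) ^ 2 + 2 ≤ c) (ht : l₂ b c n t < t) :
    l₂ b c n (t + 1) < t + 1 := by
  have hc : 0 < c := by omega
  have hbc : b + 1 ≤ c := by nlinarith
  have h3 := mul_l₂_le b c n (t + 1)
  have h4 := lt_mul_l₂_add (b := b) (n := n) (s := t) hc
  have h5 := mul_r₂_le b c n (t + 1)
  have h6 := lt_mul_r₂_add (b := b) (n := n) (s := t) hc
  have h7 : r₂ b c n (t + 1) < r₂ b c n t + 2 := by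
    refine Nat.lt_of_mul_lt_mul_left (a := c) ?_
    rw [mul_add b] at h5
    rw [mul_add c]
    omega
  have h8 : (b + 1) * r₂ b c n (t + 1) ≤ (b + 1) * (r₂ b c n t + 1) :=
    Nat.mul_le_mul_left _ (by omega)
  have h9 : c * (l₂ b c n t + 1) ≤ c * t := Nat.mul_le_mul_left _ ht
  refine Nat.lt_of_mul_lt_mul_left (a := c) ?_
  rw [mul_add c t]
  rw [mul_add] at h8 h9
  omega

/-- The set that maximum sets are compared with. -/
lemma avoids_Icc_union_Ioc {b c n s : ℕ} (hb : 0 < b) (hc : 0 < c) (hs : l₂ b c n s < s)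
    (hsl : s ≤ l₁ b c n) :
    Avoids b c (Finset.Icc s (r₂ b c n s) ∪ Finset.Ioc (l₁ b c n) n) := by
  have h1 := lt_mul_l₁_add (b := b) (n := n) hc
  have h2 := mul_r₂_le b c n s
  have h3 := lt_mul_l₂_add (b := b) (n := n) (s := s) hc
  have h4 : c * l₂ b c n s + c ≤ c * s := by
    rw [← mul_add_one]
    exact Nat.mul_le_mul_left _ hs
  intro x hx y hy z hz h
  simp only [Finset.mem_union, Finset.mem_Icc, Finset.mem_Ioc] at hx hy hz
  rcases hz with hz | hz
  · have hz1 : c * s ≤ c * z := Nat.mul_le_mul_left _ hz.1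
    have hz2 : c * z ≤ c * r₂ b c n s := Nat.mul_le_mul_left _ hz.2
    rcases hy with hy | hy
    · have hy1 : b * s ≤ b * y := Nat.mul_le_mul_left _ hy.1
      have hy2 : b * y ≤ b * r₂ b c n s := Nat.mul_le_mul_left _ hy.2
      rcases hx with hx | hx
      · rw [add_mul, one_mul] at h3
        omega
      · omega
    · have hy1 : b * (l₁ b c n + 1) ≤ b * y := Nat.mul_le_mul_left _ hy.1
      obtain ⟨d, hd⟩ : ∃ d, l₁ b c n = s + d := ⟨l₁ b c n - s, by omega⟩
      have hd' : d ≤ b * d := Nat.le_mul_of_pos_left _ hb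
      rw [hd] at hy1 h2
      rw [mul_add, mul_one, mul_add] at hy1
      rcases hx with hx | hx
      · omega
      · omega
  · have hz1 : c * (l₁ b c n + 1) ≤ c * z := Nat.mul_le_mul_left _ hz.1
    have hy1 : b * y ≤ b * n := by
      refine Nat.mul_le_mul_left _ ?_
      rcases hy with hy | hy
      · have h5 : c * r₂ b c n s ≤ (b + 1) * l₁ b c n := by
          rw [add_mul, one_mul]
          have : b * s ≤ b * l₁ b c n := Nat.mul_le_mul_left _ hsl
          omega
        by_contra! hlt
        have h6 : (b + 1) * (n + 1) ≤ (b + 1) * r₂ b c n s := Nat.mul_le_mul_left _ (by omega)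
        have h7 : c * s ≤ c * l₁ b c n := Nat.mul_le_mul_left _ hsl
        have h8 := mul_l₁_le b c n
        rw [mul_add, mul_one] at h6
        omega
      · exact hy.2
    have hx1 : x ≤ n := by
      rcases hx with hx | hx
      · by_contra! hlt
        have h6 : (b + 1) * (n + 1) ≤ (b + 1) * r₂ b c n s := Nat.mul_le_mul_left _ (by omega)
        have h7 : c * s ≤ c * l₁ b c n := Nat.mul_le_mul_left _ hsl
        have h8 := mul_l₁_le b c n
        rw [mul_add, mul_one] at h6
        omega
      · exact hx.2
    rw [mul_add, mul_one] at hz1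
    rw [add_mul, one_mul] at h1
    omega

lemma IsMaximum.le_card {b c n s : ℕ} {A : Finset ℕ} (hA : IsMaximum b c n A) (hb : 0 < b)
    (hq : (b + 1) ^ 2 + 2 ≤ c) (hs : l₂ b c n s < s) (hsl : s ≤ l₁ b c n) :
    r₂ b c n s + 1 - s + (n - l₁ b c n) ≤ A.card := by
  have h1 := l₁_le (n := n) hq
  have h2 := r₂_le_l₁ hq hsl
  refine le_trans (le_of_eq ?_) (hA.2.2 _ ?_ (avoids_Icc_union_Ioc hb (by omega) hs hsl))
  · rw [Finset.card_union_of_disjoint, Nat.card_Icc, Nat.card_Ioc]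
    rw [Finset.disjoint_left]
    intro x hx hy
    rw [Finset.mem_Icc] at hx
    rw [Finset.mem_Ioc] at hy
    omega
  · intro x hx
    simp only [Finset.mem_union, Finset.mem_Icc, Finset.mem_Ioc] at hx ⊢
    omega

/-! ### The position of the least element -/

lemma three_mul_le {b c P : ℕ} (hb : 1 < b) (hq : (b + 1) ^ 2 + 2 ≤ c)
    (hP : P + b * (b + 1) = c ^ 2) : 3 * c * (b + 1) ≤ P := by
  obtain ⟨d, rfl⟩ : ∃ d, b = d + 2 := ⟨b - 2, by omega⟩
  obtain ⟨f, rfl⟩ : ∃ f, c = (d + 2 + 1) ^ 2 + 2 + f := ⟨c - ((d + 2 + 1) ^ 2 + 2), by omega⟩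
  have h1 : 3 * (d + 3) + 2 ≤ (d + 2 + 1) ^ 2 + 2 + f := by nlinarith
  have h2 := Nat.mul_le_mul_left ((d + 2 + 1) ^ 2 + 2 + f) h1
  nlinarith

lemma S_bounds {b c n P : ℕ} (hc : 0 < c) (hP0 : 0 < P) (hP : P + b * (b + 1) = c ^ 2) :
    c * P * S b c n ≤ (b + 1) ^ 2 * n ∧ (b + 1) ^ 2 * n < c * P * (S b c n + 1) := by
  have hPq : ((c : ℚ) ^ 2 - b * (b + 1)) = P := by
    have : ((P + b * (b + 1) : ℕ) : ℚ) = (c ^ 2 : ℕ) := by rw [hP]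
    push_cast at this
    linarith
  have hpos : (0 : ℚ) < (c : ℚ) * P := mul_pos (Nat.cast_pos.2 hc) (Nat.cast_pos.2 hP0)
  have h1 : ((S b c n : ℕ) : ℚ) ≤ (((b : ℚ) + 1) ^ 2 * n) / ((c : ℚ) * P) := by
    rw [S, hPq]
    exact Nat.floor_le (by positivity)
  have h2 : (((b : ℚ) + 1) ^ 2 * n) / ((c : ℚ) * P) < (S b c n : ℕ) + 1 := by
    rw [S, hPq]
    exact Nat.lt_floor_add_one _
  rw [le_div_iff₀ hpos] at h1
  rw [div_lt_iff₀ hpos] at h2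
  constructor
  · have : ((c * P * S b c n : ℕ) : ℚ) ≤ ((b + 1) ^ 2 * n : ℕ) := by push_cast; linarith
    exact_mod_cast this
  · have : (((b + 1) ^ 2 * n : ℕ) : ℚ) < (c * P * (S b c n + 1) : ℕ) := by push_cast; linarith
    exact_mod_cast this

section Arithmetic

-- `P` stands for `c² - b (b + 1)` and `σ` for `S`, through the two inequalities of `S_bounds`
variable {b c n P σ : ℕ}

lemma l₂_lt_of_lt {s : ℕ} (hP : P + b * (b + 1) = c ^ 2)
    (h2 : (b + 1) ^ 2 * n < c * P * (σ + 1)) (hs : σ < s) : l₂ b c n s < s := by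
  refine Nat.lt_of_mul_lt_mul_left (a := c ^ 3) ?_
  have e1 := Nat.mul_le_mul_left (c ^ 2) (mul_l₂_le b c n s)
  have e2 := Nat.mul_le_mul_left (c * (b + 1)) (mul_r₂_le b c n s)
  have e3 := Nat.mul_le_mul_left (b + 1) (mul_l₁_le b c n)
  have e4 : c * P * (σ + 1) ≤ c * P * s := Nat.mul_le_mul_left _ hs
  have e5 : c * P * s + c * (b * (b + 1)) * s = c ^ 3 * s := by
    rw [← add_mul, ← mul_add, hP]; ring
  have e6 : c ^ 3 * l₂ b c n s = c ^ 2 * (c * l₂ b c n s) := by ring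
  have e7 : c ^ 2 * ((b + 1) * r₂ b c n s) = c * (b + 1) * (c * r₂ b c n s) := by ring
  have e8 : c * (b + 1) * (l₁ b c n + b * s) =
    (b + 1) * (c * l₁ b c n) + c * (b * (b + 1)) * s := by ring
  have e9 : (b + 1) * ((b + 1) * n) = (b + 1) ^ 2 * n := by ring
  omega

/-- Below `S` the number `(b + 1) r₂ - c s` grows linearly in the distance to `S`. -/
lemma mul_add_le_mul_r₂ {s k : ℕ} (hc : 0 < c) (hP : P + b * (b + 1) = c ^ 2)
    (h1 : c * P * σ ≤ (b + 1) ^ 2 * n) (hs : s + k = σ) :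
    c * P * k + c ^ 3 * s ≤ c ^ 2 * ((b + 1) * r₂ b c n s) + (b + 1) * c ^ 2 := by
  have e1 := Nat.mul_le_mul_left (c * (b + 1)) (lt_mul_r₂_add (b := b) (n := n) (s := s) hc)
  have e2 := Nat.mul_le_mul_left (b + 1) (lt_mul_l₁_add (b := b) (n := n) hc)
  have e5 : c * P * s + c * (b * (b + 1)) * s = c ^ 3 * s := by
    rw [← add_mul, ← mul_add, hP]; ring
  rw [← hs, mul_add] at h1
  have e7 : c ^ 2 * ((b + 1) * r₂ b c n s) + (b + 1) * c ^ 2 =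
    c * (b + 1) * (c * r₂ b c n s + c) := by ring
  have e8 : c * (b + 1) * (l₁ b c n + b * s).succ =
    (b + 1) * (c * l₁ b c n + c) + c * (b * (b + 1)) * s := by
      rw [Nat.succ_eq_add_one]; ring
  have e9 : (b + 1) * ((b + 1) * n).succ = (b + 1) ^ 2 * n + (b + 1) := by
    rw [Nat.succ_eq_add_one]; ring
  omega

lemma add_mul_le_mul_r₂ {s k : ℕ} (hb : 1 < b) (hq : (b + 1) ^ 2 + 2 ≤ c)
    (hP : P + b * (b + 1) = c ^ 2) (h1 : c * P * σ ≤ (b + 1) ^ 2 * n) (hs : s + k = σ)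
    (hk : 1 ≤ k) : c * s + (b + 1) * (k + 1) ≤ (b + 1) * r₂ b c n s := by
  have hc : 0 < c := by omega
  have e1 := mul_add_le_mul_r₂ hc hP h1 hs
  have e2 := Nat.mul_le_mul_left (c * k) (three_mul_le hb hq hP)
  refine le_of_mul_le_mul_left ?_ (by positivity : 0 < c ^ 2)
  have e3 : c ^ 2 * (b + 1) * (k + 2) ≤ c ^ 2 * (b + 1) * (3 * k) :=
    Nat.mul_le_mul_left _ (by omega)
  linarith

lemma three_mul_le_l₁ (hb : 1 < b) (hq : (b + 1) ^ 2 + 2 ≤ c) (hP : P + b * (b + 1) = c ^ 2)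
    (h1 : c * P * σ ≤ (b + 1) ^ 2 * n) : 3 * c * σ ≤ l₁ b c n := by
  have hc : 0 < c := by omega
  have e2 := Nat.mul_le_mul_left (b + 1) (lt_mul_l₁_add (b := b) (n := n) hc)
  have e3 := Nat.mul_le_mul_left (c * σ) (three_mul_le hb hq hP)
  have e4 : c * (b + 1) * (3 * c * σ) < c * (b + 1) * (l₁ b c n + 1) := by
    rw [Nat.succ_eq_add_one] at e2
    linarith
  have := Nat.lt_of_mul_lt_mul_left e4
  omega

lemma three_mul_le_r₂ (hb : 1 < b) (hq : (b + 1) ^ 2 + 2 ≤ c) (hP : P + b * (b + 1) = c ^ 2)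
    (h1 : c * P * σ ≤ (b + 1) ^ 2 * n) (s : ℕ) : 3 * σ ≤ r₂ b c n s := by
  have hc : 0 < c := by omega
  have e1 := three_mul_le_l₁ hb hq hP h1
  have e2 := lt_mul_r₂_add (b := b) (n := n) (s := s) hc
  have e4 : c * (3 * σ) < c * (r₂ b c n s + 1) := by linarith [Nat.zero_le (b * s)]
  have := Nat.lt_of_mul_lt_mul_left e4
  omega

/-- If `s` is far below `S`, the bound from a decomposition of `[s, r₂]` into two blocks falls
short of the size `r₂(S + 1) - S` of an admissible left block. -/
lemma mul_le_of_r₂_le {s k : ℕ} (hb : 1 < b) (hbc : (b + 1) * b ^ 2 + c < c * b)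
    (hP : P + b * (b + 1) = c ^ 2)
    (h1 : c * P * σ ≤ (b + 1) ^ 2 * n) (h2 : (b + 1) ^ 2 * n < c * P * (σ + 1)) (hs : s + k = σ)
    (h : r₂ b c n (σ + 1) ≤ σ + ((r₂ b c (r₂ b c n s) s + 1 - s) +
      (r₂ b c n s - l₂ b c n s))) :
    k ≤ (b + 1) * c + 3 * c ^ 2 := by
  have hq := sq_add_two_le hb hbc
  have hc : 0 < c := by omega
  have hcb : b * (b + 1) + c + 1 ≤ c * b := by nlinarith
  have hbc' : b + 1 ≤ c := by nlinarith
  have f1 := lt_mul_r₂_add (b := b) (n := n) (s := σ + 1) hc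
  have f2 := mul_r₂_le b c n s
  have f3 := mul_add_le_mul_r₂ hc hP h1 hs
  have f4 := lt_mul_l₂_add (b := b) (n := n) (s := s) hc
  have f5 : c * r₂ b c (r₂ b c n s) s ≤ l₂ b c n s + b * s := mul_r₂_le b c (r₂ b c n s) s
  have f6 : l₂ b c n s ≤ σ := by
    have := l₂_lt_of_lt hP h2 (by omega : σ < σ + 1)
    have := l₂_mono (b := b) (c := c) (n := n) (by omega : s ≤ σ + 1)
    omega
  have f7 : l₂ b c n s ≤ r₂ b c n s := by
    refine le_of_mul_le_mul_left ((mul_l₂_le b c n s).trans ?_) hc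
    exact Nat.mul_le_mul_right _ (by nlinarith)
  generalize r₂ b c n (σ + 1) = r' at *
  generalize r₂ b c (r₂ b c n s) s = r₃ at *
  generalize r₂ b c n s = r at *
  generalize l₂ b c n s = l at *
  generalize l₁ b c n = m at *
  subst hs
  have g1 : c * r + b * (k + 1) < c * r' + c := by
    have : b * (s + k + 1) = b * s + b * (k + 1) := by ring
    omega
  have g2 := Nat.mul_le_mul_left (c ^ 2) g1.le
  have g4 := Nat.mul_le_mul_left (c ^ 2) f4.le
  have g5 : c * P * k + c * (b * (b + 1)) * k = c ^ 3 * k := by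
    rw [← add_mul, ← mul_add, hP]; ring
  have g6 : c * k ≤ c * ((b + 1) * c + 3 * c ^ 2) := by
    rcases Nat.lt_or_ge r₃ s with hr | hr
    · have g3 : r' + l ≤ s + k + r := by omega
      have g3' := Nat.mul_le_mul_left (c ^ 3) g3
      have g7 : c * k * (b * (b + 1) + 1) ≤ c * k * (c * b) := Nat.mul_le_mul_left _ (by omega)
      linarith [Nat.zero_le (c ^ 2 * b), Nat.zero_le (c ^ 3)]
    · have g3 : r' + l + s ≤ s + k + r + r₃ + 1 := by omega
      have g3' := Nat.mul_le_mul_left (c ^ 3) g3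
      have f5' := Nat.mul_le_mul_left (c ^ 2) f5
      have f6' := Nat.mul_le_mul_left (c ^ 2) f6
      have g7 : c * k * (b * (b + 1) + c + 1) ≤ c * k * (c * b) :=
        Nat.mul_le_mul_left _ hcb
      have g8 : c ^ 2 * s * (b + 1) ≤ c ^ 2 * s * c := Nat.mul_le_mul_left _ hbc'
      linarith [Nat.zero_le (c ^ 2 * b), Nat.zero_le (c ^ 3)]
  exact le_of_mul_le_mul_left g6 hc

/-- Near `S` the pairs excluded by `z = s` lie within `[s, r₂]`. -/
lemma add_mul_r₂_le {s k : ℕ} (hq : (b + 1) ^ 2 + 2 ≤ c) (hP : P + b * (b + 1) = c ^ 2)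
    (h2 : (b + 1) ^ 2 * n < c * P * (σ + 1)) (hs : s + k = σ)
    (hbig : (b + 1) ^ 2 + b * c * (k + 1) ≤ s) :
    s + b * r₂ b c n s + b + 1 ≤ c * s := by
  have hc : 0 < c := by omega
  have f2 := Nat.mul_le_mul_left (b * (b + 1) * c) (mul_r₂_le b c n s)
  have f3 := Nat.mul_le_mul_left (b * (b + 1)) (mul_l₁_le b c n)
  have f4 := Nat.mul_le_mul_left b h2.le
  have f5 := Nat.mul_le_mul_left (c ^ 2) hbig
  have hPc : P ≤ c ^ 2 := by omega
  have f6 := Nat.mul_le_mul_left (b * c * (k + 1)) hPc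
  have e5 : b * c * (P + b * (b + 1)) * s = b * c * c ^ 2 * s := by rw [hP]
  have f7 : c ^ 2 * s * (b + 2) ≤ c ^ 2 * s * c := Nat.mul_le_mul_left _ (by nlinarith)
  refine le_of_mul_le_mul_left ?_ (by positivity : 0 < (b + 1) * c ^ 2)
  subst hs
  generalize r₂ b c n s = r at *
  generalize l₁ b c n = m at *
  linarith

end Arithmetic

/-- A bound for `S` from which on the position of the least element can be determined. -/
def depth (b c : ℕ) : ℕ :=
  threshold b c + ((b + 1) * c + 3 * c ^ 2) + (b + 1) ^ 2 +
    b * c * ((b + 1) * c + 3 * c ^ 2 + 1) + 10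

lemma div_succ_lt_card_Icc_sdiff {b c m s e : ℕ} (hb : 0 < b) {A : Finset ℕ}
    (hA : Avoids b c A) (hs : s ∈ A) (hs1 : 1 ≤ s) (he : c * s + e = (b + 1) * m)
    (hm : s + e ≤ m) : e / (b + 1) < (Finset.Icc s m \ A).card := by
  have h := div_succ_lt_card_Ioc_sdiff hb hA hs he (T := s - 1) (by omega)
  have h1 : Finset.Ioc (s - 1) m = Finset.Icc s m := by
    ext x
    rw [Finset.mem_Ioc, Finset.mem_Icc]
    omega
  rwa [h1] at h

lemma card_inter_Iic_add {s m : ℕ} {A : Finset ℕ} (hs : ∀ x ∈ A, s ≤ x) :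
    (A ∩ Finset.Iic m).card + (Finset.Icc s m \ A).card = m + 1 - s := by
  have h1 : A ∩ Finset.Iic m = Finset.Icc s m ∩ A := by
    ext x
    simp only [Finset.mem_inter, Finset.mem_Iic, Finset.mem_Icc]
    constructor
    · rintro ⟨h1, h2⟩
      exact ⟨⟨hs x h1, h2⟩, h1⟩
    · rintro ⟨h1, h2⟩
      exact ⟨h2, h1.2⟩
  rw [h1, add_comm, Finset.card_sdiff_add_card_inter, Nat.card_Icc]

section Least

variable {b c n P σ s : ℕ} {A : Finset ℕ}

lemma depth_le_of_le (hσ : depth b c ≤ σ) {k : ℕ} (hk : k ≤ (b + 1) * c + 3 * c ^ 2)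
    (hs : s + k = σ) : (b + 1) ^ 2 + b * c * (k + 1) ≤ s := by
  have : b * c * (k + 1) ≤ b * c * ((b + 1) * c + 3 * c ^ 2 + 1) :=
    Nat.mul_le_mul_left _ (by omega)
  unfold depth at hσ
  omega

lemma depth_le_of_pow_mul_le (hP : P + b * (b + 1) = c ^ 2)
    (h2 : (b + 1) ^ 2 * n < c * P * (σ + 1)) (hn : c ^ 3 * depth b c ≤ n) : depth b c ≤ σ := by
  by_contra! hlt
  have h3 : c * P * (σ + 1) ≤ c * c ^ 2 * depth b c :=
    Nat.mul_le_mul (Nat.mul_le_mul_left _ (by omega)) hlt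
  have h4 : 1 * n ≤ (b + 1) ^ 2 * n := Nat.mul_le_mul_right _ (Nat.one_le_pow _ _ (by omega))
  have h5 : c * c ^ 2 * depth b c = c ^ 3 * depth b c := by ring
  omega

lemma card_le_card_Iic_add (hb : 1 < b) (hbc : (b + 1) * b ^ 2 + c < c * b)
    (hn : threshold b c ≤ n) (hA : Avoids b c A) (hAn : A ⊆ Finset.Icc 1 n) (hs : s ∈ A) :
    A.card ≤ (A ∩ Finset.Iic (r₂ b c n s)).card + (n - l₁ b c n) := by
  have h1 := card_add_card_missing_le b c s hAn
  have h2 := (card_inter_Ioc_le hb hbc hn hA hs).1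
  omega

/-- A maximum set has no element below `S`: such an element `s` excludes more elements of
`[s, r₂]` than are gained on the left. -/
lemma le_of_isMaximum (hb : 1 < b) (hbc : (b + 1) * b ^ 2 + c < c * b)
    (hP : P + b * (b + 1) = c ^ 2)
    (h1 : c * P * σ ≤ (b + 1) ^ 2 * n) (h2 : (b + 1) ^ 2 * n < c * P * (σ + 1))
    (hσ : depth b c ≤ σ) (hn : threshold b c ≤ n) (hA : IsMaximum b c n A) (hs : s ∈ A)
    (hmin : ∀ x ∈ A, s ≤ x) : σ ≤ s := by
  by_contra! hlt
  have hq := sq_add_two_le hb hbc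
  have hσ' : threshold b c + 10 ≤ σ := by unfold depth at hσ; omega
  obtain ⟨k, hk⟩ : ∃ k, s + k = σ := ⟨σ - s, by omega⟩
  have hs1 : 1 ≤ s := (Finset.mem_Icc.1 (hA.1 hs)).1
  have hr := three_mul_le_r₂ hb hq hP h1 s
  have hl := three_mul_le_l₁ hb hq hP h1
  have hlow := hA.le_card (by omega) hq (l₂_lt_of_lt hP h2 (by omega : σ < σ + 1)) (by nlinarith)
  have hup := card_le_card_Iic_add hb hbc hn hA.2.1 hA.1 hs
  -- the same upper bound with `r₂` in place of `n`, for which `l₁` becomes `l₂`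
  have hk0 : k ≤ (b + 1) * c + 3 * c ^ 2 := by
    refine mul_le_of_r₂_le hb hbc hP h1 h2 hk ?_
    have hA2 : Avoids b c (A ∩ Finset.Iic (r₂ b c n s)) := fun x hx y hy z hz =>
      hA.2.1 x (Finset.mem_inter.1 hx).1 y (Finset.mem_inter.1 hy).1 z (Finset.mem_inter.1 hz).1
    have hA2n : A ∩ Finset.Iic (r₂ b c n s) ⊆ Finset.Icc 1 (r₂ b c n s) := by
      intro x hx
      rw [Finset.mem_inter, Finset.mem_Iic] at hx
      exact Finset.mem_Icc.2 ⟨(Finset.mem_Icc.1 (hA.1 hx.1)).1, hx.2⟩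
    have hup2 := card_le_card_Iic_add hb hbc (by omega) hA2 hA2n
      (Finset.mem_inter.2 ⟨hs, Finset.mem_Iic.2 (by omega)⟩)
    have hA2min : ∀ x ∈ A ∩ Finset.Iic (r₂ b c n s), s ≤ x := fun x hx =>
      hmin x (Finset.mem_inter.1 hx).1
    have h3 := card_inter_Iic_add (m := r₂ b c (r₂ b c n s) s) hA2min
    have h4 : l₁ b c (r₂ b c n s) = l₂ b c n s := rfl
    rw [h4] at hup2
    omega
  have hbig := depth_le_of_le hσ hk0 hk
  have hnear := add_mul_r₂_le hq hP h2 hk hbig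
  have hgrow := add_mul_le_mul_r₂ hb hq hP h1 hk (by omega)
  obtain ⟨e, he⟩ : ∃ e, c * s + e = (b + 1) * r₂ b c n s :=
    ⟨(b + 1) * r₂ b c n s - c * s, by omega⟩
  have he1 : k + 1 ≤ e / (b + 1) := by
    rw [Nat.le_div_iff_mul_le (Nat.succ_pos b)]
    linarith
  have hloss := div_succ_lt_card_Icc_sdiff (by omega) hA.2.1 hs hs1 he
    (by rw [add_mul, one_mul] at he; omega)
  have hcard := card_inter_Iic_add (m := r₂ b c n s) hmin
  have hmono := r₂_mono (b := b) (c := c) (n := n) (by omega : s ≤ σ + 1)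
  omega

/-- Moving the least element two or more places to the right shortens the left block. -/
lemma le_add_one_of_isMaximum {t : ℕ} (hb : 1 < b) (hbc : (b + 1) * b ^ 2 + c < c * b)
    (hn : threshold b c ≤ n) (hA : IsMaximum b c n A) (hs : s ∈ A)
    (hmin : ∀ x ∈ A, s ≤ x) (ht : l₂ b c n t < t) (htl : t ≤ l₁ b c n)
    (htr : t ≤ r₂ b c n t) : s ≤ t + 1 := by
  by_contra! hlt
  have hq := sq_add_two_le hb hbc
  have hc : 0 < c := by omega
  have hbc2 : 2 * b ≤ c := by nlinarith
  have hlow := hA.le_card (by omega) hq ht htl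
  have hup := card_le_card_Iic_add hb hbc hn hA.2.1 hA.1 hs
  have hcard := card_inter_Iic_add (m := r₂ b c n s) hmin
  obtain ⟨j, rfl⟩ : ∃ j, s = t + j := ⟨s - t, by omega⟩
  have hr : r₂ b c n (t + j) < r₂ b c n t + j := by
    refine Nat.lt_of_mul_lt_mul_left (a := c) ?_
    have h1 := mul_r₂_le b c n (t + j)
    have h2 := lt_mul_r₂_add (b := b) (n := n) (s := t) hc
    have h3 : 2 * b * j ≤ c * j := Nat.mul_le_mul_right _ hbc2
    have h4 : c * 2 ≤ c * j := Nat.mul_le_mul_left _ (by omega)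
    linarith
  omega

end Least

/-! ### The shape of the two blocks -/

section Shape

variable {b c n s : ℕ} {A : Finset ℕ}

/-- If the missing elements of the upper block are only just balanced, nothing of `A` lies strictly
between `r₂ + 1` and `l₁`: such a `z` would exclude several of `c z - b (s + j)`. -/
lemma le_r₂_succ_or_l₁_le (hb : 1 < b) (hbc : (b + 1) * b ^ 2 + c < c * b)
    (hn : threshold b c ≤ n) (hA : Avoids b c A) (hs : s ∈ A)
    (hbal : (missing b c n A).card ≤ (A ∩ Finset.Ioc (r₂ b c n s) (l₁ b c n)).card)
    (hone : (Finset.Icc s (r₂ b c n s) \ A).card ≤ 1) (hsr : s + 3 ≤ r₂ b c n s) :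
    ∀ z ∈ A, z ≤ r₂ b c n s + 1 ∨ l₁ b c n ≤ z := by
  have hq := sq_add_two_le hb hbc
  have hc : 0 < c := by omega
  have hbc3 : 3 * b < c := by nlinarith
  obtain ⟨h1, h2⟩ := (card_inter_Ioc_le hb hbc hn hA hs).2 hbal
  intro z hz
  by_contra! hlt
  have hzcut : z ≤ cut b c n := by
    by_contra! hlt'
    have := h1 z hz hlt' (by omega)
    omega
  have hlo : l₁ b c n + b * s + c < c * z := by
    have h3 := lt_mul_r₂_add (b := b) (n := n) (s := s) hc
    have h4 : c * (r₂ b c n s + 2) ≤ c * z := Nat.mul_le_mul_left _ hlt.1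
    rw [mul_add] at h4
    omega
  have hhi : c * z ≤ c * cut b c n := Nat.mul_le_mul_left _ hzcut
  have hcut := mul_cut_add_le hq hn
  have key : ∀ j, 1 ≤ j → j ≤ 3 → s + j ∈ A → c * z - b * (s + j) ∈ missingHigh b c n s A := by
    intro j hj1 hj3 hj
    have h5 : b * j ≤ b * 3 := Nat.mul_le_mul_left _ hj3
    have h6 : 0 < b * j := Nat.mul_pos (by omega) hj1
    have h7 : b * (s + j) = b * s + b * j := by ring
    simp only [missingHigh, missing, Finset.mem_filter, Finset.mem_sdiff, Finset.mem_Ioc]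
    refine ⟨⟨⟨by omega, by omega⟩, fun hx => hA _ hx _ hj z hz (by omega)⟩, ?_⟩
    rintro ⟨-, hd⟩
    have h8 : c ∣ (c * z - b * (s + j) + b * s) + b * j := by
      rw [show c * z - b * (s + j) + b * s + b * j = c * z by omega]
      exact Dvd.intro _ rfl
    have h9 := Nat.le_of_dvd h6 ((Nat.dvd_add_right hd).1 h8)
    omega
  have pair : ∀ i j, 1 ≤ i → i < j → j ≤ 3 → s + i ∈ A → s + j ∈ A → False := by
    intro i j hi hij hj hiA hjA
    have h5 := Finset.card_le_one.1 h2 _ (key i hi (by omega) hiA) _ (key j (by omega) hj hjA)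
    have h6 : b * (s + i) < b * (s + j) := Nat.mul_lt_mul_of_pos_left (by omega) (by omega)
    have h7 : b * (s + j) ≤ b * (s + 3) := Nat.mul_le_mul_left _ (by omega)
    rw [mul_add b s 3] at h7
    omega
  have gap : ∀ i j, 1 ≤ i → i < j → j ≤ 3 → s + i ∉ A → s + j ∉ A → False := by
    intro i j hi hij hj hiA hjA
    have h5 := Finset.card_le_one.1 hone (s + i)
      (Finset.mem_sdiff.2 ⟨Finset.mem_Icc.2 (by omega), hiA⟩) (s + j)
      (Finset.mem_sdiff.2 ⟨Finset.mem_Icc.2 (by omega), hjA⟩)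
    omega
  by_cases a1 : s + 1 ∈ A
  · by_cases a2 : s + 2 ∈ A
    · exact pair 1 2 (by omega) (by omega) (by omega) a1 a2
    · by_cases a3 : s + 3 ∈ A
      · exact pair 1 3 (by omega) (by omega) (by omega) a1 a3
      · exact gap 2 3 (by omega) (by omega) (by omega) a2 a3
  · by_cases a2 : s + 2 ∈ A
    · by_cases a3 : s + 3 ∈ A
      · exact pair 2 3 (by omega) (by omega) (by omega) a2 a3
      · exact gap 1 3 (by omega) (by omega) (by omega) a1 a3
    · exact gap 1 2 (by omega) (by omega) (by omega) a1 a2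

/-- In the balanced case the missing elements are as many as the elements `r₂ + 1` and `l₁` that
`A` contains, and each of these two excludes one. -/
lemma rightBlock_of_balanced (hb : 1 < b) (hbc : (b + 1) * b ^ 2 + c < c * b)
    (hn : threshold b c ≤ n) (hA : Avoids b c A) (hs : s ∈ A)
    (hbal : (missing b c n A).card ≤ (A ∩ Finset.Ioc (r₂ b c n s) (l₁ b c n)).card)
    (hgap : ∀ z ∈ A, z ≤ r₂ b c n s + 1 ∨ l₁ b c n ≤ z) (hrl : r₂ b c n s + 1 < l₁ b c n)
    (hsucc : r₂ b c n s + 1 ∈ A → s + 1 ∈ A) :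
    RightBlock b c n s A (A ∩ Finset.Icc (l₁ b c n) n) := by
  have hq := sq_add_two_le hb hbc
  have hc : 0 < c := by omega
  have hln := l₁_le (n := n) hq
  have hcut := mul_cut_add_le hq hn
  obtain ⟨h1, -⟩ := (card_inter_Ioc_le hb hbc hn hA hs).2 hbal
  have hmem : ∀ x, x ∈ missing b c n A ↔ l₁ b c n < x ∧ x ≤ n ∧ x ∉ A := by
    intro x
    rw [missing, Finset.mem_sdiff, Finset.mem_Ioc, and_assoc]
  have hG : A ∩ Finset.Ioc (r₂ b c n s) (l₁ b c n) ⊆ {r₂ b c n s + 1, l₁ b c n} := by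
    intro x hx
    rw [Finset.mem_inter, Finset.mem_Ioc] at hx
    have := hgap x hx.1
    rw [Finset.mem_insert, Finset.mem_singleton]
    omega
  -- the element excluded by `r₂ + 1` and the least element
  have hlow : r₂ b c n s + 1 ∈ A → ∃ ξ, 1 ≤ ξ ∧
      c * (r₂ b c n s + 1) = b * s + (l₁ b c n + ξ) ∧ l₁ b c n + ξ ∈ missing b c n A ∧
      l₁ b c n + ξ ≤ c * cut b c n := by
    intro hrA
    have h2 := lt_mul_r₂_add (b := b) (n := n) (s := s) hc
    have h3 : r₂ b c n s + 1 ≤ cut b c n := by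
      by_contra! hlt
      have := h1 _ hrA hlt (by omega)
      omega
    have h4 : c * (r₂ b c n s + 1) ≤ c * cut b c n := Nat.mul_le_mul_left _ h3
    have h5 : c * (r₂ b c n s + 1) = c * r₂ b c n s + c := by ring
    refine ⟨c * (r₂ b c n s + 1) - (b * s + l₁ b c n), by omega, by omega, ?_, by omega⟩
    rw [hmem]
    exact ⟨by omega, by omega, fun hx => hA _ hx s hs _ hrA (by omega)⟩
  -- the elements one of which is excluded by `l₁`
  have hhigh : l₁ b c n ∈ A → ∃ ξ, ξ ≤ n ∧ c * l₁ b c n + ξ = (b + 1) * n ∧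
      c * cut b c n < n - ξ ∧ (n ∈ missing b c n A ∨ n - ξ ∈ missing b c n A) := by
    intro hlA
    have h2 := mul_l₁_le b c n
    obtain ⟨h3, h4, h5⟩ := exists_mem_missingHigh (s := s) (ξ := (b + 1) * n - c * l₁ b c n)
      (by omega) hq hn hA hlA (by omega)
    refine ⟨(b + 1) * n - c * l₁ b c n, by omega, by omega, h4, ?_⟩
    exact h5.imp (fun h => (Finset.mem_filter.1 h).1) (fun h => (Finset.mem_filter.1 h).1)
  unfold RightBlock
  clear h1 hgap
  generalize r₂ b c n s = r at *
  generalize missing b c n A = K at *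
  generalize l₁ b c n = l at *
  have hsingle : ∀ x, K.card ≤ 1 → x ∈ K → ∀ y, y ∈ K ↔ y = x := fun x h hx y =>
    ⟨fun hy => Finset.card_le_one.1 h y hy x hx, fun hy => hy ▸ hx⟩
  refine ⟨fun hrA hlA => ?_, fun hrA hlA => ?_, fun hrA hlA => ?_, fun hrA hlA => ?_⟩
  · have h2 : A ∩ Finset.Ioc r l = ∅ := by
      refine Finset.eq_empty_of_forall_notMem fun x hx => ?_
      have h3 := Finset.mem_insert.1 (hG hx)
      rw [Finset.mem_singleton] at h3
      rcases h3 with rfl | rfl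
      · exact hrA (Finset.mem_inter.1 hx).1
      · exact hlA (Finset.mem_inter.1 hx).1
    have h3 : K = ∅ := by
      rw [h2, Finset.card_empty] at hbal
      exact Finset.card_eq_zero.1 (by omega)
    ext x
    have h4 := hmem x
    rw [h3] at h4
    simp only [Finset.notMem_empty, false_iff] at h4
    rw [Finset.mem_inter, Finset.mem_Icc, Finset.mem_Ioc]
    constructor
    · rintro ⟨h5, h6, h7⟩
      have : x ≠ l := fun h => hlA (h ▸ h5)
      omega
    · intro h5
      exact ⟨by_contra fun h => h4 ⟨h5.1, h5.2, h⟩, by omega, h5.2⟩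
  · have h2 : K.card ≤ 1 := by
      refine hbal.trans ((Finset.card_le_card (t := {l}) fun x hx => ?_).trans (by simp))
      have h3 := Finset.mem_insert.1 (hG hx)
      rcases h3 with rfl | h3
      · exact absurd (Finset.mem_inter.1 hx).1 hrA
      · exact h3
    obtain ⟨ξ, hξn, hξ, hcξ, h3⟩ := hhigh hlA
    rcases h3 with h3 | h3
    · left
      have h4 := hsingle _ h2 h3
      ext x
      have h5 := hmem x
      rw [h4] at h5
      rw [Finset.mem_inter, Finset.mem_Icc, Finset.mem_Ico]
      by_cases hxl : x = l
      · subst hxl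
        have := (hmem n).1 h3
        simp only [hlA, true_and]
        omega
      · by_cases hxA : x ∈ A
        · simp only [hxA, true_and, not_true, and_false, iff_false] at h5 ⊢
          omega
        · simp only [hxA, false_and, not_false_eq_true, and_true, false_iff] at h5 ⊢
          omega
    · right
      refine ⟨ξ, hξn, hξ, ?_⟩
      have h4 := hsingle _ h2 h3
      ext x
      have h5 := hmem x
      rw [h4] at h5
      rw [Finset.mem_inter, Finset.mem_sdiff, Finset.mem_Icc, Finset.mem_singleton]
      by_cases hxl : x = l
      · subst hxl
        have := (hmem _).1 h3
        simp only [hlA, true_and]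
        omega
      · by_cases hxA : x ∈ A
        · simp only [hxA, true_and, not_true, and_false, iff_false] at h5 ⊢
          omega
        · simp only [hxA, false_and, not_false_eq_true, and_true, false_iff] at h5 ⊢
          omega
  · have h2 : K.card ≤ 1 := by
      refine hbal.trans ((Finset.card_le_card (t := {r + 1}) fun x hx => ?_).trans (by simp))
      have h3 := Finset.mem_insert.1 (hG hx)
      rw [Finset.mem_singleton] at h3 ⊢
      rcases h3 with h3 | rfl
      · exact h3
      · exact absurd (Finset.mem_inter.1 hx).1 hlA
    obtain ⟨ξ, hξ1, hξ, hξK, hξcut⟩ := hlow hrA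
    refine ⟨ξ, hξ1, by omega, hξ, ?_⟩
    have h4 := hsingle _ h2 hξK
    ext x
    have h5 := hmem x
    rw [h4] at h5
    rw [Finset.mem_inter, Finset.mem_sdiff, Finset.mem_Icc, Finset.mem_Ioc, Finset.mem_singleton]
    by_cases hxl : x = l
    · subst hxl
      simp only [hlA, false_and, false_iff]
      omega
    · by_cases hxA : x ∈ A
      · simp only [hxA, true_and, not_true, and_false, iff_false] at h5 ⊢
        omega
      · simp only [hxA, false_and, not_false_eq_true, and_true, false_iff] at h5 ⊢
        omega
  · have h2 : K.card ≤ 2 :=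
      hbal.trans ((Finset.card_le_card hG).trans Finset.card_le_two)
    obtain ⟨ξ, hξ1, hξ, hξK, hξcut⟩ := hlow hrA
    obtain ⟨ζ, hζn, hζ, hcζ, h3⟩ := hhigh hlA
    have hpair : ∀ x, c * cut b c n < x → x ∈ K → ∀ y, y ∈ K ↔ y = l + ξ ∨ y = x := by
      intro x hx hxK
      have h4 : ({l + ξ, x} : Finset ℕ) = K := by
        refine Finset.eq_of_subset_of_card_le ?_ ?_
        · intro y hy
          rw [Finset.mem_insert, Finset.mem_singleton] at hy
          rcases hy with rfl | rfl
          · exact hξK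
          · exact hxK
        · rw [Finset.card_pair (by omega)]
          exact h2
      intro y
      rw [← h4, Finset.mem_insert, Finset.mem_singleton]
    -- `s + 1` and `r₂ + 1` exclude `l₁ + ξ - b` as well
    have hξb : ξ ≤ b - 1 := by
      by_contra! hlt
      have h4 : b * (s + 1) = b * s + b := by ring
      have h5 : l + ξ - b ∉ A := fun hx => hA _ hx _ (hsucc hrA) _ hrA (by omega)
      have h6 : l + ξ - b ≠ l := fun h => h5 (by rw [h]; exact hlA)
      have h7 : l + ξ - b ∈ K := (hmem _).2 ⟨by omega, by omega, h5⟩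
      rcases h3 with h3 | h3
      · have := (hpair n (by omega) h3 _).1 h7
        omega
      · have := (hpair _ hcζ h3 _).1 h7
        omega
    refine ⟨ξ, hξ1, hξb, hξ, ?_⟩
    rcases h3 with h3 | h3
    · left
      have h4 := hpair n (by omega) h3
      ext x
      have h5 := hmem x
      rw [h4] at h5
      rw [Finset.mem_inter, Finset.mem_sdiff, Finset.mem_Icc, Finset.mem_Ico,
        Finset.mem_singleton]
      by_cases hxl : x = l
      · subst hxl
        have := (hmem n).1 h3
        simp only [hlA, true_and]
        omega
      · by_cases hxA : x ∈ A
        · simp only [hxA, true_and, not_true, and_false, iff_false] at h5 ⊢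
          omega
        · simp only [hxA, false_and, not_false_eq_true, and_true, false_iff] at h5 ⊢
          omega
    · right
      refine ⟨ζ, hζn, hζ, ?_⟩
      have h4 := hpair _ hcζ h3
      ext x
      have h5 := hmem x
      rw [h4] at h5
      rw [Finset.mem_inter, Finset.mem_sdiff, Finset.mem_Icc, Finset.mem_insert,
        Finset.mem_singleton]
      by_cases hxl : x = l
      · subst hxl
        have := (hmem _).1 h3
        simp only [hlA, true_and]
        omega
      · by_cases hxA : x ∈ A
        · simp only [hxA, true_and, not_true, and_false, iff_false] at h5 ⊢
          omega
        · simp only [hxA, false_and, not_false_eq_true, and_true, false_iff] at h5 ⊢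
          omega

end Shape

section Left

variable {b c n s : ℕ} {A : Finset ℕ}

lemma inter_Iic_eq_sdiff {s m : ℕ} {X : Finset ℕ} (hs : ∀ x ∈ A, s ≤ x)
    (hX : Finset.Icc s m \ A = X) : A ∩ Finset.Iic m = Finset.Icc s m \ X := by
  subst hX
  ext x
  simp only [Finset.mem_inter, Finset.mem_Iic, Finset.mem_sdiff, Finset.mem_Icc]
  constructor
  · rintro ⟨h1, h2⟩
    exact ⟨⟨hs x h1, h2⟩, fun h => h.2 h1⟩
  · rintro ⟨h1, h2⟩
    exact ⟨by_contra fun h => h2 ⟨h1, h⟩, h1.2⟩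

lemma inter_Iic_succ_of_notMem {m : ℕ} (h : m + 1 ∉ A) :
    A ∩ Finset.Iic (m + 1) = A ∩ Finset.Iic m := by
  ext x
  simp only [Finset.mem_inter, Finset.mem_Iic]
  constructor
  · rintro ⟨h1, h2⟩
    have : x ≠ m + 1 := fun h3 => h (h3 ▸ h1)
    exact ⟨h1, by omega⟩
  · rintro ⟨h1, h2⟩
    exact ⟨h1, by omega⟩

lemma leftBlock_of_sPrime_le (hs : sPrime b c n ≤ s) (hmin : ∀ x ∈ A, s ≤ x)
    (hsr : s ≤ r₂ b c n s) (hfull : Finset.Icc s (r₂ b c n s) \ A = ∅) :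
    LeftBlock b c n s (A ∩ Finset.Iic (r₂ b c n s + 1)) := by
  refine ⟨fun _ => ?_, fun h => absurd hs (by omega)⟩
  have h1 := inter_Iic_eq_sdiff hmin hfull
  rw [Finset.sdiff_empty] at h1
  by_cases h : r₂ b c n s + 1 ∈ A
  · right
    ext x
    have h2 : x ∈ A ∩ Finset.Iic (r₂ b c n s) ↔ x ∈ Finset.Icc s (r₂ b c n s) := by rw [h1]
    simp only [Finset.mem_inter, Finset.mem_Iic, Finset.mem_Icc] at h2 ⊢
    by_cases hx : x = r₂ b c n s + 1
    · subst hx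
      simp only [h, true_and]
      omega
    · by_cases hxA : x ∈ A
      · simp only [hxA, true_and] at h2 ⊢
        omega
      · simp only [hxA, false_and, false_iff] at h2 ⊢
        omega
  · left
    rw [inter_Iic_succ_of_notMem h, h1]

/-- If `s ≤ l₂` and only one element of `[s, r₂]` is missing, then the pair `r₂`, `r₂ - e` with
`e = (b + 1) r₂ - c s` contains it, and `r₂ + 1` cannot belong to `A` as it would allow for a
second pair. -/
lemma leftBlock_of_lt_sPrime {e : ℕ} (hb : 0 < b) (hA : Avoids b c A) (hsA : s ∈ A)
    (hs1 : 1 ≤ s) (hs : s < sPrime b c n) (hmin : ∀ x ∈ A, s ≤ x) (hl : l₂ b c n s = s)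
    (he : c * s + e = (b + 1) * r₂ b c n s) (hr : s + e + b ≤ r₂ b c n s)
    (hone : (Finset.Icc s (r₂ b c n s) \ A).card = 1) :
    r₂ b c n s + 1 ∉ A ∧ LeftBlock b c n s (A ∩ Finset.Iic (r₂ b c n s + 1)) := by
  have hnot : r₂ b c n s + 1 ∉ A := by
    intro h
    have he' : c * s + (e + (b + 1)) = (b + 1) * (r₂ b c n s + 1) := by
      rw [← add_assoc, he]; ring
    have h1 := div_succ_lt_card_Icc_sdiff hb hA hsA hs1 he' (by omega)
    have h0 : 1 ≤ (e + (b + 1)) / (b + 1) := Nat.div_pos (by omega) (by omega)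
    have h2 : Finset.Icc s (r₂ b c n s + 1) \ A = Finset.Icc s (r₂ b c n s) \ A := by
      ext x
      simp only [Finset.mem_sdiff, Finset.mem_Icc]
      constructor
      · rintro ⟨h3, h4⟩
        have : x ≠ r₂ b c n s + 1 := fun h5 => h4 (h5 ▸ h)
        exact ⟨by omega, h4⟩
      · rintro ⟨h3, h4⟩
        exact ⟨by omega, h4⟩
    rw [h2] at h1
    omega
  refine ⟨hnot, fun h => absurd hs (by omega), fun _ => ?_⟩
  rw [inter_Iic_succ_of_notMem hnot]
  have h1 := div_succ_lt_card_Icc_sdiff hb hA hsA hs1 he (by omega)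
  have heb : e ≤ b := by
    by_contra! hlt
    have : 1 ≤ e / (b + 1) := Nat.div_pos (by omega) (by omega)
    omega
  obtain ⟨w, hw⟩ := Finset.card_eq_one.1 hone
  have hsingle : ∀ x, s ≤ x → x ≤ r₂ b c n s → x ∉ A → Finset.Icc s (r₂ b c n s) \ A = {x} := by
    intro x h2 h3 h4
    have h5 : x ∈ Finset.Icc s (r₂ b c n s) \ A :=
      Finset.mem_sdiff.2 ⟨Finset.mem_Icc.2 ⟨h2, h3⟩, h4⟩
    rw [hw] at h5 ⊢
    rw [Finset.mem_singleton.1 h5]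
  by_cases hrA : r₂ b c n s ∈ A
  · right
    have h2 : r₂ b c n s - e ∉ A := by
      intro hx
      refine hA _ hx _ hrA _ hsA ?_
      rw [add_mul, one_mul] at he
      omega
    have he0 : e ≠ 0 := by
      rintro rfl
      exact h2 hrA
    refine ⟨e, by omega, heb, by rw [hl]; exact he, ?_⟩
    exact inter_Iic_eq_sdiff hmin (hsingle _ (by omega) (by omega) h2)
  · left
    rw [inter_Iic_eq_sdiff hmin (hsingle _ (by omega) le_rfl hrA)]
    ext x
    simp only [Finset.mem_sdiff, Finset.mem_Icc, Finset.mem_singleton, Finset.mem_Ico]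
    omega

end Left

end FamilyOne

theorem theorem2p5 (b c : ℕ) (hb : 1 < b)
    (hc : ((b : ℚ) + 1) * (b : ℚ) ^ 2 / ((b : ℚ) - 1) < (c : ℚ)) :
    ∃ N : ℕ, ∀ n : ℕ, N ≤ n → ∀ A : Finset ℕ, FamilyOne.IsMaximum b c n A →
      ∃ s : ℕ, IsLeast (A : Set ℕ) s ∧
        FamilyOne.S b c n ≤ s ∧ s ≤ FamilyOne.S b c n + 2 ∧
        ∃ I₂ I₁ : Finset ℕ, A = I₂ ∪ I₁ ∧
          FamilyOne.LeftBlock b c n s I₂ ∧ FamilyOne.RightBlock b c n s A I₁ := by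
  open FamilyOne in
  have hbc : (b + 1) * b ^ 2 + c < c * b := by
    have hb1 : (0 : ℚ) < (b : ℚ) - 1 := by
      have : (1 : ℚ) < b := by exact_mod_cast hb
      linarith
    rw [div_lt_iff₀ hb1] at hc
    have : (((b + 1) * b ^ 2 + c : ℕ) : ℚ) < (c * b : ℕ) := by push_cast; linarith
    exact_mod_cast this
  have hq := sq_add_two_le hb hbc
  have hc0 : 0 < c := by omega
  obtain ⟨P, hP⟩ : ∃ P, P + b * (b + 1) = c ^ 2 := ⟨c ^ 2 - b * (b + 1), by
    have : b * (b + 1) ≤ c ^ 2 := by nlinarith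
    omega⟩
  have hP0 : 0 < P := by
    have := three_mul_le hb hq hP
    have h1 : 0 < 3 * c * (b + 1) := by positivity
    omega
  refine ⟨threshold b c + c ^ 3 * depth b c, fun n hN A hA => ?_⟩
  have hn : threshold b c ≤ n := le_trans (Nat.le_add_right _ _) hN
  obtain ⟨h1, h2⟩ := S_bounds (n := n) hc0 hP0 hP
  have hσ := depth_le_of_pow_mul_le hP h2 (le_trans (Nat.le_add_left _ _) hN)
  generalize S b c n = σ at *
  have hσ10 : 10 ≤ σ := by unfold depth at hσ; omega
  have hl := three_mul_le_l₁ hb hq hP h1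
  have hσl : 2 * (σ + 1) ≤ l₁ b c n := by nlinarith
  have hln := l₁_le (n := n) hq
  have hr := three_mul_le_r₂ hb hq hP h1
  have hσ1 := l₂_lt_of_lt hP h2 (by omega : σ < σ + 1)
  have hlow := hA.le_card (by omega) hq hσ1 (by omega)
  have hr1 := hr (σ + 1)
  have hne : A.Nonempty := Finset.card_pos.1 (by omega)
  obtain ⟨s, hsA, hmin⟩ := A.exists_min_image id hne
  simp only [id] at hmin
  have hs1 : 1 ≤ s := (Finset.mem_Icc.1 (hA.1 hsA)).1
  have hσs := le_of_isMaximum hb hbc hP h1 h2 hσ hn hA hsA hmin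
  have hmem : 1 ≤ sPrime b c n ∧ sPrime b c n ≤ n ∧
      l₂ b c n (sPrime b c n) < sPrime b c n :=
    Nat.sInf_mem (s := {s : ℕ | 1 ≤ s ∧ s ≤ n ∧ l₂ b c n s < s}) ⟨σ + 1, by omega, by omega, hσ1⟩
  have hle : sPrime b c n ≤ σ + 1 := Nat.sInf_le ⟨by omega, by omega, hσ1⟩
  have hst := le_add_one_of_isMaximum hb hbc hn hA hsA hmin hmem.2.2 (by omega)
    (by have := hr (sPrime b c n); omega)
  have hcount := card_add_card_missing_le b c s hA.1
  have hG := (card_inter_Ioc_le hb hbc hn hA.2.1 hsA).1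
  have hcard := card_inter_Iic_add (m := r₂ b c n s) hmin
  have hrs := hr s
  have hrl : r₂ b c n s + 1 < l₁ b c n := by
    have h3 := mul_r₂_le b c n s
    have h4 : b * s ≤ b * r₂ b c n s := Nat.mul_le_mul_left _ (by omega)
    have h5 : (b + 4) * r₂ b c n s ≤ c * r₂ b c n s := Nat.mul_le_mul_right _ (by nlinarith)
    rw [add_mul] at h5
    omega
  -- both cases for `s` lead to the two blocks once the left one is known to be full enough
  suffices hmain : (missing b c n A).card ≤ (A ∩ Finset.Ioc (r₂ b c n s) (l₁ b c n)).card ∧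
      (Finset.Icc s (r₂ b c n s) \ A).card ≤ 1 ∧ (r₂ b c n s + 1 ∈ A → s + 1 ∈ A) ∧
      LeftBlock b c n s (A ∩ Finset.Iic (r₂ b c n s + 1)) by
    obtain ⟨hbal, hone, hsucc, hleft⟩ := hmain
    have hgap := le_r₂_succ_or_l₁_le hb hbc hn hA.2.1 hsA hbal hone (by omega)
    refine ⟨s, ⟨hsA, fun x hx => hmin x hx⟩, hσs, by omega, _, _, ?_, hleft,
      rightBlock_of_balanced hb hbc hn hA.2.1 hsA hbal hgap hrl hsucc⟩
    rw [← Finset.inter_union_distrib_left]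
    refine (Finset.inter_eq_left.2 fun x hx => ?_).symm
    rw [Finset.mem_union, Finset.mem_Iic, Finset.mem_Icc]
    exact (hgap x hx).imp id fun h => ⟨h, (Finset.mem_Icc.1 (hA.1 hx)).2⟩
  rcases Nat.lt_or_ge s (sPrime b c n) with hlt | hge
  · have hs : s = σ := by omega
    subst hs
    have hsl : l₂ b c n s = s := by
      have h3 := l₂_mono (b := b) (c := c) (n := n) (by omega : s ≤ s + 1)
      have h4 : ¬ (1 ≤ s ∧ s ≤ n ∧ l₂ b c n s < s) := Nat.notMem_of_lt_sInf hlt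
      omega
    have h3 := mul_l₂_le b c n s
    rw [hsl] at h3
    obtain ⟨e, he⟩ : ∃ e, c * s + e = (b + 1) * r₂ b c n s :=
      ⟨(b + 1) * r₂ b c n s - c * s, by omega⟩
    have hnear := add_mul_r₂_le hq hP h2 (add_zero s)
      (depth_le_of_le hσ (Nat.zero_le _) (add_zero s))
    have hre : s + e + b ≤ r₂ b c n s := by
      rw [add_mul, one_mul] at he
      omega
    have hloss := div_succ_lt_card_Icc_sdiff (by omega) hA.2.1 hsA hs1 he (by omega)
    have hmono := r₂_mono (b := b) (c := c) (n := n) (by omega : s ≤ s + 1)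
    have he0 := Nat.zero_le (e / (b + 1))
    have hone : (Finset.Icc s (r₂ b c n s) \ A).card = 1 := by omega
    obtain ⟨hnot, hleft⟩ := leftBlock_of_lt_sPrime (by omega) hA.2.1 hsA hs1 hlt hmin hsl he hre hone
    exact ⟨by omega, hone.le, fun h => absurd h hnot, hleft⟩
  · have hsl : l₂ b c n s < s := by
      rcases Nat.lt_or_ge (sPrime b c n) s with hlt | hge'
      · have hs : s = sPrime b c n + 1 := by omega
        rw [hs]
        exact l₂_succ_lt hq hmem.2.2
      · have : s = sPrime b c n := by omega
        rw [this]
        exact hmem.2.2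
    have hlow' := hA.le_card (by omega) hq hsl (by omega)
    have hfull : Finset.Icc s (r₂ b c n s) \ A = ∅ := Finset.card_eq_zero.1 (by omega)
    refine ⟨by omega, by omega, fun _ => ?_, leftBlock_of_sPrime_le hge hmin (by omega) hfull⟩
    by_contra h
    have : s + 1 ∈ Finset.Icc s (r₂ b c n s) \ A :=
      Finset.mem_sdiff.2 ⟨Finset.mem_Icc.2 (by omega), h⟩
    rw [hfull] at this
    exact Finset.notMem_empty _ this
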